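/- **Setting.** Let $n,m\ge 0$ be integers and $R>0$. The complex projective superspace $\mathbf{CP}^{n|m}=(\mathbf C^{n+1|m}\setminus\{0\})/\mathbf C^*$, with homogeneous coordinates $z^0,\dots,z^n\,|\,\zeta^1,\dots,\zeta^m$, is the supermanifold glued from the $n+1$ affine charts $\mathbf C^{n|m}$ with coordinates $w^a=z^a/z^k$ ($a\neq k$) and $\theta^\mu=\zeta^\mu/z^k$, $k=0,\dots,n$. Write $w^a=x^a+iy^a$ and $\theta^\mu=\xi^\mu+i\eta^\mu$ with real $x^a,y^a,\xi^\mu,\eta^\mu$, and $\bar w^a=x^a-iy^a$, $\bar\theta^\mu=\xi^\mu-i\eta^\mu$. The super Fubini–Study structure at scale $R$ is given in each chart by the Kähler potential $R^2\ln N$, where $N=1+\sum_a w^a\bar w^a+i\sum_\mu\theta^\mu\bar\theta^\mu$. That is, the Hermitian form $H$ has components $h_{a\bar b}=R^2\,\partial_a\partial_{\bar b}\ln N$ (left derivatives; $a,b$ run over even and odd coordinates), the Riemannian metric is $g=\operatorname{Re}H$, and the symplectic form is $\omega=\frac i2R^2\,\partial\bar\partial\ln N=-\operatorname{Im}H$,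 normalized so that for $m=0$ the Liouville volume element is $\omega^n/n!$. For $T=g$ or $T=\omega$, with matrix $(T_{AB})$ in the real coordinates, the induced (Riemannian, respectively Liouville) volume element is $$\sqrt{\operatorname{Ber}(T_{AB})}\;D(x^1,y^1,\dots,x^n,y^n\,|\,\xi^1,\eta^1,\dots,\xi^m,\eta^m),$$ where the square root has positive body and $$\operatorname{Ber}\begin{pmatrix}J_{00}&J_{01}\\J_{10}&J_{11}\end{pmatrix}=\frac{\det(J_{00}-J_{01}J_{11}^{-1}J_{10})}{\det J_{11}}.$$ The volume $\operatorname{vol}(\mathbf{CP}^{n|m}_R)$ is the Berezin integral of this volume element over $\mathbf{CP}^{n|m}$: the sum over the charts of the integrals of its products with the functions of a smooth partition of unity subordinate to the charts. Such a partition exists, and the sum does not depend on its choice. The integral over the odd coordinates is normalized by $\int D(\xi^1,\eta^1,\dots,\xi^m,\eta^m)\,e^{-2\sum_\mu\xi^\mu\eta^\mu}=2^m$. **Theorem.** For all $n,m\ge0$ and $R>0$, both the Riemannian and the Liouville volume of $\mathbf{CP}^{n|m}_R$ equal $$\operatorname{vol}(\mathbf{CP}^{n|m}_R)=R^{2(n-m)}\,\frac{\pi^n\,2^m}{\Gamma(n-m+1)},$$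 where $1/\Gamma$ is understood to be $0$ at the poles of $\Gamma$. In particular, $\operatorname{vol}(\mathbf{CP}^{n|m}_R)=0$ if $m>n$, and $\operatorname{vol}(\mathbf{CP}^{1|1}_R)=2\pi$ for every $R>0$. -/

import Mathlib

open scoped ContDiff
open MeasureTheory

noncomputable section

namespace SuperCP

/-! ### Grassmann algebra -/

/-- The Grassmann algebra (with complex coefficients) on the `2m` real odd coordinates
`ξ^1, η^1, …, ξ^m, η^m`. -/
abbrev Grassmann (m : ℕ) : Type := ExteriorAlgebra ℂ (Fin m ⊕ Fin m → ℂ)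

variable {n m : ℕ}

/-- The real odd coordinate `ξ^μ`. -/
def xi (μ : Fin m) : Grassmann m := ExteriorAlgebra.ι ℂ (Pi.single (Sum.inl μ) 1)

/-- The real odd coordinate `η^μ`. -/
def eta (μ : Fin m) : Grassmann m := ExteriorAlgebra.ι ℂ (Pi.single (Sum.inr μ) 1)

/-- The complex odd coordinate `θ^μ = ξ^μ + i η^μ`. -/
def theta (μ : Fin m) : Grassmann m := xi μ + Complex.I • eta μ

/-- The conjugate odd coordinate `ξ^μ - i η^μ`. -/
def thetaBar (μ : Fin m) : Grassmann m := xi μ - Complex.I • eta μ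

/-- The body map (all odd coordinates set to zero). -/
def body : Grassmann m →ₐ[ℂ] ℂ := ExteriorAlgebra.algebraMapInv

/-- The left partial derivative with respect to an odd coordinate. -/
def oddDeriv (κ : Fin m ⊕ Fin m) : Grassmann m →ₗ[ℂ] Grassmann m :=
  CliffordAlgebra.contractLeft (LinearMap.proj κ)

/-- The even part of the Grassmann algebra. -/
abbrev EvenGrassmann (m : ℕ) : Subalgebra ℂ (Grassmann m) :=
  CliffordAlgebra.even (0 : QuadraticForm ℂ (Fin m ⊕ Fin m → ℂ))

theorem ι_mul_ι_anticomm (u v : Fin m ⊕ Fin m → ℂ) :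
    (ExteriorAlgebra.ι ℂ u * ExteriorAlgebra.ι ℂ v : Grassmann m)
      = -(ExteriorAlgebra.ι ℂ v * ExteriorAlgebra.ι ℂ u) :=
  eq_neg_of_add_eq_zero_left (ExteriorAlgebra.ι_add_mul_swap u v)

theorem even_commute {a : Grassmann m} (ha : a ∈ EvenGrassmann m) (b : Grassmann m) :
    a * b = b * a := by
  have key : ∀ x (_ : x ∈ CliffordAlgebra.evenOdd
      (0 : QuadraticForm ℂ (Fin m ⊕ Fin m → ℂ)) 0), ∀ v,
      x * ExteriorAlgebra.ι ℂ v = ExteriorAlgebra.ι ℂ v * x := by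
    intro x hx
    induction x, hx using CliffordAlgebra.even_induction with
    | algebraMap r => intro v; exact Algebra.commutes r _
    | add x y hx hy h1 h2 => intro v; rw [add_mul, mul_add, h1, h2]
    | ι_mul_ι_mul u w x hx h =>
      intro v
      change ExteriorAlgebra.ι ℂ u * ExteriorAlgebra.ι ℂ w * x * ExteriorAlgebra.ι ℂ v
        = ExteriorAlgebra.ι ℂ v * (ExteriorAlgebra.ι ℂ u * ExteriorAlgebra.ι ℂ w * x)
      have e : (ExteriorAlgebra.ι ℂ u * ExteriorAlgebra.ι ℂ w * ExteriorAlgebra.ι ℂ v :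
          Grassmann m)
          = ExteriorAlgebra.ι ℂ v * (ExteriorAlgebra.ι ℂ u * ExteriorAlgebra.ι ℂ w) := by
        rw [mul_assoc, ι_mul_ι_anticomm w v, mul_neg, ← mul_assoc, ι_mul_ι_anticomm u v,
          neg_mul, neg_neg, mul_assoc]
      rw [mul_assoc _ x, h v, ← mul_assoc, e, mul_assoc]
  induction b using ExteriorAlgebra.induction with
  | algebraMap r => exact (Algebra.commutes r a).symm
  | ι v => exact key a ha v
  | mul x y hx hy => rw [← mul_assoc, hx, mul_assoc, hy, mul_assoc]
  | add x y hx hy => rw [mul_add, add_mul, hx, hy]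

instance evenGrassmannCommRing : CommRing (EvenGrassmann m) :=
  { (inferInstance : Ring (EvenGrassmann m)) with
    mul_comm := fun a b => Subtype.ext (even_commute a.2 b) }

/-- The projection of the Grassmann algebra onto its even part. -/
def evenPart (a : Grassmann m) : EvenGrassmann m :=
  ⟨(DirectSum.decompose (CliffordAlgebra.evenOdd
      (0 : QuadraticForm ℂ (Fin m ⊕ Fin m → ℂ))) a 0 : Grassmann m),
    (DirectSum.decompose (CliffordAlgebra.evenOdd
      (0 : QuadraticForm ℂ (Fin m ⊕ Fin m → ℂ))) a 0).2⟩

/-- The value at `a` of a real function `F`, smooth near the (real) body of the even element `a`: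
`F(a) = ∑_j F^{(j)}(a₀) / j! · (a - a₀)^j`, a finite sum since `a - a₀` is nilpotent. -/
def superEval (F : ℝ → ℝ) (a : Grassmann m) : Grassmann m :=
  ∑ j ∈ Finset.range (2 * m + 1),
    ((iteratedDeriv j F (body a).re / (j.factorial : ℝ) : ℝ) : ℂ) •
      (a - algebraMap ℂ (Grassmann m) (body a)) ^ j

/-- The Berezinian `det(J₀₀ - J₀₁ J₁₁⁻¹ J₁₀) / det J₁₁` of an even supermatrix (diagonal blocks
with even entries, off-diagonal blocks with odd entries). For such a matrix the projection
`evenPart` changes nothing; it only moves the entries into a commutative ring. -/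
def ber {p q : Type} [Fintype p] [DecidableEq p] [Fintype q] [DecidableEq q]
    (J : Matrix (p ⊕ q) (p ⊕ q) (Grassmann m)) : EvenGrassmann m :=
  ((J.toBlocks₁₁ - J.toBlocks₁₂ * Ring.inverse J.toBlocks₂₂ * J.toBlocks₂₁).map evenPart).det *
    Ring.inverse (J.toBlocks₂₂.map evenPart).det

/-- The Berezin integral over the odd coordinates with respect to
`D(ξ^1, η^1, …, ξ^m, η^m)`, as an iterated integral; it is normalized by
`∫ D(ξ^1, η^1, …, ξ^m, η^m) η^m ξ^m ⋯ η^1 ξ^1 = 1`. Equivalently,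
`∫ D(ξ^1, …, η^m) exp(-2 ∑ ξ^μ η^μ) = 2 ^ m`. -/
def oddIntegral : Grassmann m →ₗ[ℂ] ℂ :=
  body.toLinearMap ∘ₗ (List.finRange m).foldr
    (fun μ g => oddDeriv (Sum.inl μ) ∘ₗ oddDeriv (Sum.inr μ) ∘ₗ g) LinearMap.id

/-! ### Functions on the superdomain `ℂ^{n|m}` (real dimension `2n|2m`) -/

/-- (Not necessarily smooth) functions of `w ∈ ℂ^n` and of the odd coordinates `ξ^μ, η^μ`. -/
abbrev ChartFun (n m : ℕ) : Type := (Fin n → ℂ) → Grassmann m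

/-- The basis of the Grassmann algebra formed by the ordered monomials in the odd coordinates. -/
def monomials (m : ℕ) : Module.Basis (Finset (Fin m ⊕ₗ Fin m)) ℂ (Grassmann m) :=
  ((Pi.basisFun ℂ (Fin m ⊕ Fin m)).reindex toLex).ExteriorAlgebra

/-- Smoothness: all coefficients of the expansion in the odd coordinates are smooth. -/
def IsSmooth (f : ChartFun n m) : Prop :=
  ∀ s, ContDiff ℝ ∞ (fun w => (monomials m).repr (f w) s)

/-- The derivative (coefficientwise) in the real direction `v ∈ ℂ^n = ℝ^{2n}`. -/
def evenDeriv (v : Fin n → ℂ) (f : ChartFun n m) : ChartFun n m := fun w =>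
  ∑ s, lineDeriv ℝ (fun u => (monomials m).repr (f u) s) w v • monomials m s

/-- The derivatives with respect to the real parts `x^a`, `ξ^μ` of the complex coordinates
`w^a = x^a + i y^a`, `θ^μ = ξ^μ + i η^μ`. -/
def derivRe : Fin n ⊕ Fin m → ChartFun n m → ChartFun n m
  | Sum.inl a, f => evenDeriv (Pi.single a 1) f
  | Sum.inr μ, f => fun w => oddDeriv (Sum.inl μ) (f w)

/-- The derivatives with respect to the imaginary parts `y^a`, `η^μ`. -/
def derivIm : Fin n ⊕ Fin m → ChartFun n m → ChartFun n m
  | Sum.inl a, f => evenDeriv (Pi.single a Complex.I) f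
  | Sum.inr μ, f => fun w => oddDeriv (Sum.inr μ) (f w)

/-- The holomorphic left derivative with respect to `w^a` or `θ^μ`. -/
def dHol (a : Fin n ⊕ Fin m) (f : ChartFun n m) : ChartFun n m :=
  (1 / 2 : ℂ) • (derivRe a f - Complex.I • derivIm a f)

/-- The antiholomorphic left derivative with respect to `w̄^a` or `θ̄^μ`. -/
def dBar (a : Fin n ⊕ Fin m) (f : ChartFun n m) : ChartFun n m :=
  (1 / 2 : ℂ) • (derivRe a f + Complex.I • derivIm a f)

/-! ### Hermitian forms in real coordinates -/

/-- Real coordinates `(x^a, y^a | ξ^μ, η^μ)`. -/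
abbrev RealIdx (n m : ℕ) : Type := (Fin n ⊕ Fin n) ⊕ (Fin m ⊕ Fin m)

/-- The complex coordinate (`w^a` or `θ^μ`) of which a real coordinate is the real or imaginary
part. -/
def cplx : RealIdx n m → Fin n ⊕ Fin m
  | Sum.inl c => Sum.inl (Sum.elim id id c)
  | Sum.inr c => Sum.inr (Sum.elim id id c)

/-- The number `c_A`, equal to `1` for `x^a`, `ξ^μ` and to `i` for `y^a`, `η^μ`. The real
coordinate fields are `∂_A = c_A ∂_a + c̄_A ∂_ā`, `a` being the complex coordinate of `A`. -/
def unit : RealIdx n m → ℂ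
  | Sum.inl c => Sum.elim (fun _ => 1) (fun _ => Complex.I) c
  | Sum.inr c => Sum.elim (fun _ => 1) (fun _ => Complex.I) c

/-- The sign `(-1)^{ãb̃}`. -/
def koszul {α β γ δ : Type} : α ⊕ β → γ ⊕ δ → ℂ
  | Sum.inr _, Sum.inr _ => -1
  | _, _ => 1

/-- For a Hermitian form `H` with components `h_{a b̄} = H(∂_a, ∂_b̄)`, the matrix of the metric
`Re H` in real coordinates: since `H(∂_A, ∂_B) = c_A c̄_B h_{a b̄}` and since the complex conjugate
of `h_{a b̄}` is `(-1)^{ãb̃} h_{b ā}`, it is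
`½ (c_A c̄_B h_{a b̄} + (-1)^{ãb̃} c̄_A c_B h_{b ā})`. -/
def reMatrix (h : Matrix (Fin n ⊕ Fin m) (Fin n ⊕ Fin m) (Grassmann m)) :
    Matrix (RealIdx n m) (RealIdx n m) (Grassmann m) := fun A B =>
  (1 / 2 : ℂ) • ((unit A * star (unit B)) • h (cplx A) (cplx B)
    + (koszul A B * star (unit A) * unit B) • h (cplx B) (cplx A))

/-- The matrix, in real coordinates, of the two-form `-Im H` (which is `(i/2) ∂∂̄K` when
`h_{a b̄} = ∂_a ∂_b̄ K`; normalized so that on `ℂ^n` it is `∑ dx^a ∧ dy^a`, with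
`(dx^a ∧ dy^a)(∂_{x^a}, ∂_{y^a}) = 1`). -/
def negImMatrix (h : Matrix (Fin n ⊕ Fin m) (Fin n ⊕ Fin m) (Grassmann m)) :
    Matrix (RealIdx n m) (RealIdx n m) (Grassmann m) := fun A B =>
  (Complex.I / 2) • ((unit A * star (unit B)) • h (cplx A) (cplx B)
    - (koszul A B * star (unit A) * unit B) • h (cplx B) (cplx A))

/-- The density `√(Ber T_{AB})` of the volume element `√(Ber T_{AB}) D(x, y | ξ, η)` of an even
nondegenerate tensor `T` of rank two (the square root with positive body). -/
def sqrtBer (T : Matrix (RealIdx n m) (RealIdx n m) (Grassmann m)) : Grassmann m :=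
  superEval Real.sqrt (ber T : Grassmann m)

/-! ### The complex projective superspace

`CP^{n|m}` is glued from `n + 1` affine charts `ℂ^{n|m}`. If `z^0, …, z^n | ζ^1, …, ζ^m` are the
homogeneous coordinates, the coordinates of the `k`-th chart are `z^a / z^k` (`a ≠ k`) and
`ζ^μ / z^k`. -/

/-- The even homogeneous coordinates, with `z^k = 1`, of a point of the `k`-th chart. -/
def homog (k : Fin (n + 1)) (w : Fin n → ℂ) : Fin (n + 1) → ℂ :=
  Fin.insertNth (α := fun _ => ℂ) k 1 w

/-- The even part of the transition from the `k`-th chart to the `l`-th chart, defined where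
`homog k w l ≠ 0`. -/
def transition (k l : Fin (n + 1)) (w : Fin n → ℂ) : Fin n → ℂ := fun b =>
  homog k w (l.succAbove b) / homog k w l

/-- The substitution `θ^μ ↦ c θ^μ`, `θ̄^μ ↦ c̄ θ̄^μ`, that is,
`ξ^μ ↦ (Re c) ξ^μ - (Im c) η^μ`, `η^μ ↦ (Im c) ξ^μ + (Re c) η^μ`. -/
def oddScale (c : ℂ) : Grassmann m →ₐ[ℂ] Grassmann m :=
  ExteriorAlgebra.map ((Pi.basisFun ℂ (Fin m ⊕ Fin m)).constr ℂ (Sum.elim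
    (fun μ => (c.re : ℂ) • Pi.single (Sum.inl μ) 1 - (c.im : ℂ) • Pi.single (Sum.inr μ) 1)
    (fun μ => (c.im : ℂ) • Pi.single (Sum.inl μ) 1 + (c.re : ℂ) • Pi.single (Sum.inr μ) 1)))

/-- The pullback to the `k`-th chart of a function on the `l`-th chart: the substitution
`w'^b = z^b / z^l`, `θ'^μ = θ^μ / z^l`, where `z = homog k w`; meaningful where `z^l ≠ 0`. -/
def pullback (k l : Fin (n + 1)) (f : ChartFun n m) : ChartFun n m := fun w =>
  oddScale (homog k w l)⁻¹ (f (transition k l w))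

/-- A global smooth function on `CP^{n|m}`: smooth functions in all charts that agree on the
overlaps. -/
structure GlobalFun (n m : ℕ) where
  toFun : Fin (n + 1) → ChartFun n m
  smooth : ∀ k, IsSmooth (toFun k)
  compatible : ∀ k l w, homog k w l ≠ 0 → toFun k w = pullback k l (toFun l) w

/-- A smooth partition of unity on `CP^{n|m}` subordinate to the cover by the affine charts: even
functions `ρ_k` with sum `1`, the support of `ρ_k` being a compact subset of the `k`-th chart. -/
structure PartitionOfUnity (n m : ℕ) where
  ρ : Fin (n + 1) → GlobalFun n m
  even : ∀ k l w, (ρ k).toFun l w ∈ EvenGrassmann m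
  compact_support : ∀ k, HasCompactSupport ((ρ k).toFun k)
  vanishing : ∀ k l w, homog l w k = 0 → (ρ k).toFun l w = 0
  sum_eq_one : ∀ l w, ∑ k, (ρ k).toFun l w = 1

/-- `HasTotalIntegral D V`: the Berezin integral over `CP^{n|m}` of the volume element given in the
`k`-th chart by `D_k(w, ξ, η) D(x^1, y^1, …, x^n, y^n | ξ^1, η^1, …, ξ^m, η^m)` exists and equals
`V`. It is computed by a partition of unity, `∑_k ∫ ρ_k D_k`, and is required not to depend on the
choice of the latter. -/
def HasTotalIntegral (D : Fin (n + 1) → ChartFun n m) (V : ℂ) : Prop :=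
  Nonempty (PartitionOfUnity n m) ∧
  ∀ P : PartitionOfUnity n m,
    (∀ k, Integrable (fun w : Fin n → ℂ => oddIntegral ((P.ρ k).toFun k w * D k w))) ∧
    ∑ k, ∫ w : Fin n → ℂ, oddIntegral ((P.ρ k).toFun k w * D k w) = V

/-! ### The Fubini–Study form and its volume elements -/

/-- The Hermitian square `N = ∑ z^a z̄^a + i ∑ ζ^μ ζ̄^μ` of the homogeneous coordinate vector, in
the `k`-th chart (where `z^k = 1`, so that `N = 1 + ∑ w^a w̄^a + i ∑ θ^μ θ̄^μ`). -/
def hermSq (k : Fin (n + 1)) : ChartFun n m := fun w =>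
  algebraMap ℂ (Grassmann m) (∑ a, homog k w a * star (homog k w a))
    + Complex.I • ∑ μ, theta μ * thetaBar μ

/-- The Hermitian form `h_{a b̄} = R² ∂_a ∂_b̄ ln N` of the Fubini–Study structure at scale `R`, in
the `k`-th chart. -/
def fubiniStudy (R : ℝ) (k : Fin (n + 1)) (w : Fin n → ℂ) :
    Matrix (Fin n ⊕ Fin m) (Fin n ⊕ Fin m) (Grassmann m) := fun a b =>
  ((R : ℂ) ^ 2) • dHol a (dBar b (fun u => superEval Real.log (hermSq k u))) w

/-- The Riemannian volume element of `CP^{n|m}_R`, i.e. that of the metric `Re H`. -/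
def riemannianVolumeElement (n m : ℕ) (R : ℝ) (k : Fin (n + 1)) : ChartFun n m := fun w =>
  sqrtBer (reMatrix (fubiniStudy R k w))

/-- The Liouville volume element of `CP^{n|m}_R`, i.e. that of the symplectic form
`ω = (i/2) R² ∂∂̄ ln N`. -/
def liouvilleVolumeElement (n m : ℕ) (R : ℝ) (k : Fin (n + 1)) : ChartFun n m := fun w =>
  sqrtBer (negImMatrix (fubiniStudy R k w))

end SuperCP

end

/-! Write r = 1 + |w|² and N = r + τ, with τ = i ∑ θ^μ θ̄^μ even and nilpotent. Functions of N are
Taylor polynomials in τ (`evalTau`), so calculus in N is one-variable calculus at r.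

Density. The metric and the symplectic form are both α h + β hᵗ in real coordinates, up to phases
and Koszul signs, with 4αβ = 1. Such a real form splits into a holomorphic and a conjugate half with
equal determinants, so both have the same Berezinian det(S)² / ((-1)^m det(H)²), where H is the
odd-odd block of h and S its Schur complement (`ber_tensorMatrix`). Up to scalars, H is a
perturbation of the identity by the matrix θ^ν θ̄^μ, a rank-one matrix built from odd vectors. For
these the matrix determinant lemma holds with the determinant inverted
(`det_one_sub_smul_mul_of_anticomm`). The resulting factors of r cancel between S and H, and the
density is R^{2(n-m)} N^{m-n-1} (`sqrtBer_tensorMatrix_fubiniStudy`).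

Odd integral. Integrating F(r + τ) over the odd variables gives (-2)^m F^{(m)}(r)
(`oddIntegral_evalTau`). For F = x^{m-n-1} this is 2^m n!/Γ(n-m+1) times r^{-n-1}, a constant
multiple of the invariant volume density of CP^n.

Globalization. The functions of a partition of unity may depend on the odd coordinates, so the odd
integral cannot be taken first with them left aside. Instead, r^{n+1} ∫ f N^{m-n-1} over the odd
variables does not depend on the chart (`invariantIntegrand_transition`). The Gaussian measure on
C^{n+1}, pushed forward by the affine coordinates of any chart, has density π n!/r^{n+1}
(`map_affine_gaussian`). All chart integrals thus become integrals over the same space C^{n+1},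
where the partition sums to 1; the total Gaussian mass π^{n+1} then gives the volume
(`sum_integral_partition`). -/

noncomputable section

namespace SuperCP

section TaylorExpansion

/-! ### Truncated Taylor expansions at nilpotent elements -/

/-- The truncated Taylor expansion `∑_{j < K} F^{(j)}(r) / j! · t ^ j`. -/
def taylorAt {A : Type*} [Ring A] [Algebra ℂ A] (t : A) (K : ℕ) (F : ℝ → ℝ) (r : ℝ) : A :=
  ∑ j ∈ Finset.range K, ((iteratedDeriv j F r / (j.factorial : ℝ) : ℝ) : ℂ) • t ^ j

section Taylor

variable {A : Type*} [Ring A] [Algebra ℂ A] {t : A} {K : ℕ} {F G : ℝ → ℝ} {r : ℝ}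

/-- The Leibniz formula for the derivatives of F G is the Cauchy product of the Taylor coefficients;
the products of total degree at least K that truncation would lose are killed by t ^ K = 0. -/
theorem taylorAt_mul (ht : t ^ K = 0) (hF : ContDiffAt ℝ ∞ F r) (hG : ContDiffAt ℝ ∞ G r) :
    taylorAt t K F r * taylorAt t K G r = taylorAt t K (F * G) r := by
  set f : ℕ → ℂ := fun j => ((iteratedDeriv j F r / (j.factorial : ℝ) : ℝ) : ℂ) with hf
  set g : ℕ → ℂ := fun j => ((iteratedDeriv j G r / (j.factorial : ℝ) : ℝ) : ℂ) with hg
  have hvan : ∀ j, K ≤ j → t ^ j = 0 := fun j hj => pow_eq_zero_of_le hj ht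
  have h1 : taylorAt t K F r * taylorAt t K G r
      = ∑ i ∈ Finset.range K, ∑ j ∈ Finset.range (K - i), (f i * g j) • t ^ (i + j) := by
    unfold taylorAt
    rw [Finset.sum_mul_sum]
    refine Finset.sum_congr rfl fun i hi => ?_
    rw [← Finset.sum_subset (Finset.range_mono (Nat.sub_le K i))]
    · refine Finset.sum_congr rfl fun j _ => ?_
      rw [smul_mul_smul_comm, pow_add]
    · intro j _ hj
      rw [Finset.mem_range, not_lt] at hj
      rw [smul_mul_smul_comm, ← pow_add, hvan _ (by omega), smul_zero]
  rw [h1, ← Finset.sum_range_diag_flip K (fun i j => (f i * g j) • t ^ (i + j))]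
  refine Finset.sum_congr rfl fun l _ => ?_
  have h2 : ((iteratedDeriv l (F * G) r / (l.factorial : ℝ) : ℝ) : ℂ)
      = ∑ i ∈ Finset.range (l + 1), f i * g (l - i) := by
    rw [iteratedDeriv_mul (hF.of_le (by exact_mod_cast le_top))
      (hG.of_le (by exact_mod_cast le_top)), Finset.sum_div, Complex.ofReal_sum]
    refine Finset.sum_congr rfl fun i hi => ?_
    have hil : i ≤ l := Nat.lt_succ_iff.mp (Finset.mem_range.mp hi)
    rw [hf, hg, ← Complex.ofReal_mul, Nat.cast_choose ℝ hil]
    congr 1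
    have := Nat.factorial_ne_zero l
    have := Nat.factorial_ne_zero i
    have := Nat.factorial_ne_zero (l - i)
    field_simp
  rw [h2, Finset.sum_smul]
  refine Finset.sum_congr rfl fun i hi => ?_
  have hil : i ≤ l := Nat.lt_succ_iff.mp (Finset.mem_range.mp hi)
  rw [Nat.add_sub_cancel' hil]

theorem taylorAt_congr (h : F =ᶠ[nhds r] G) : taylorAt t K F r = taylorAt t K G r := by
  unfold taylorAt
  refine Finset.sum_congr rfl fun j _ => ?_
  rw [(h.iteratedDeriv_eq j)]

theorem taylorAt_const (hK : 0 < K) (c : ℝ) :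
    taylorAt t K (fun _ => c) r = algebraMap ℂ A c := by
  unfold taylorAt
  rw [Finset.sum_eq_single 0]
  · simp [Algebra.algebraMap_eq_smul_one]
  · intro j _ hj
    simp [iteratedDeriv_const, hj]
  · intro h
    simp at h
    omega

theorem taylorAt_id (ht : t ^ K = 0) (hK : 0 < K) :
    taylorAt t K (fun x => x) r = algebraMap ℂ A r + t := by
  -- With K = 1 the truncation has no linear term, so one more term is kept; it is zero because t ^
  -- K = 0.
  have : taylorAt t (K + 1) (fun x => x) r = algebraMap ℂ A r + t := by
    unfold taylorAt
    rw [Finset.sum_range_succ', Finset.sum_eq_single 0]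
    · simp [Algebra.algebraMap_eq_smul_one, iteratedDeriv_one, add_comm]
    · intro j _ hj
      rw [iteratedDeriv_succ']
      have : deriv (fun x : ℝ => x) = fun _ => 1 := by funext x; exact deriv_id x
      rw [this, iteratedDeriv_const]
      simp [hj]
    · intro h
      simp at h
      omega
  rw [← this]
  unfold taylorAt
  rw [Finset.sum_range_succ, ht, smul_zero, add_zero]

theorem map_taylorAt {B : Type*} [Ring B] [Algebra ℂ B] (φ : A →ₐ[ℂ] B) :
    φ (taylorAt t K F r) = taylorAt (φ t) K F r := by
  simp [taylorAt]

theorem taylorAt_zero (hK : 0 < K) : taylorAt (0 : A) K F r = algebraMap ℂ A (F r) := by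
  unfold taylorAt
  rw [Finset.sum_eq_single 0]
  · simp [Algebra.algebraMap_eq_smul_one]
  · intro j _ hj
    simp [hj]
  · intro h
    simp at h
    omega

/-- The Taylor expansion minus its constant term is a multiple of `t`. -/
theorem taylorAt_sub_algebraMap (hK : 0 < K) :
    ∃ b : A, Commute t b ∧ taylorAt t K F r - algebraMap ℂ A (F r) = t * b := by
  obtain ⟨K, rfl⟩ : ∃ k, K = k + 1 := ⟨K - 1, by omega⟩
  refine ⟨∑ j ∈ Finset.range K,
    ((iteratedDeriv (j + 1) F r / ((j + 1).factorial : ℝ) : ℝ) : ℂ) • t ^ j, ?_, ?_⟩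
  · exact Commute.sum_right _ _ _ fun j _ => ((Commute.refl t).pow_right j).smul_right _
  · unfold taylorAt
    rw [Finset.sum_range_succ', Finset.mul_sum]
    simp [Algebra.algebraMap_eq_smul_one, pow_succ']

theorem taylorAt_smul (c : ℝ) :
    taylorAt t K (fun x => c * F x) r = (c : ℂ) • taylorAt t K F r := by
  unfold taylorAt
  rw [Finset.smul_sum]
  refine Finset.sum_congr rfl fun j _ => ?_
  rw [iteratedDeriv_const_mul_field, smul_smul, mul_div_assoc, Complex.ofReal_mul]

theorem taylorAt_neg : taylorAt t K (fun x => - F x) r = - taylorAt t K F r := by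
  simpa using taylorAt_smul (t := t) (K := K) (F := F) (r := r) (-1)

end Taylor

/-- In a commutative `ℂ`-algebra, square roots congruent to a common unit modulo the nilradical are
equal. -/
theorem eq_of_sq_eq_sq {A : Type*} [CommRing A] [Algebra ℂ A] {x y : A} {c : ℂ} (hc : c ≠ 0)
    (hx : IsNilpotent (x - algebraMap ℂ A c)) (hy : IsNilpotent (y - algebraMap ℂ A c))
    (h : x ^ 2 = y ^ 2) : x = y := by
  -- The sum is the unit 2c plus a nilpotent element, so it can be cancelled from (x + y)(x - y) =
  -- 0.
  have hu : IsUnit (x + y) := by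
    have h1 : x + y = algebraMap ℂ A (2 * c)
        + ((x - algebraMap ℂ A c) + (y - algebraMap ℂ A c)) := by
      rw [map_mul, map_ofNat]; ring
    have h2 : IsUnit (algebraMap ℂ A (2 * c)) :=
      (IsUnit.mk0 (2 * c) (mul_ne_zero two_ne_zero hc)).map (algebraMap ℂ A)
    rw [h1]
    exact (((Commute.all _ _).isNilpotent_add hx hy)).isUnit_add_left_of_commute h2
      (Commute.all _ _)
  have h3 : (x + y) * (x - y) = (x + y) * 0 := by linear_combination h
  exact sub_eq_zero.mp (hu.mul_left_cancel h3)

/-- The square root of the square of a Taylor expansion with positive constant term. -/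
theorem taylorAt_sqrt_sq {A : Type*} [CommRing A] [Algebra ℂ A] {t : A} {K : ℕ} {F : ℝ → ℝ}
    {r : ℝ} (ht : t ^ K = 0) (hK : 0 < K) (h0 : 0 < F r) :
    taylorAt (taylorAt t K F r ^ 2 - algebraMap ℂ A ((F r ^ 2 : ℝ) : ℂ)) K Real.sqrt (F r ^ 2)
      = taylorAt t K F r := by
  set X := taylorAt t K F r with hX
  obtain ⟨b, -, hb⟩ := taylorAt_sub_algebraMap (t := t) (F := F) (r := r) hK
  rw [← hX] at hb
  set ν := X ^ 2 - algebraMap ℂ A ((F r ^ 2 : ℝ) : ℂ) with hν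
  -- The increment at which the root is expanded is itself a multiple of t, so the same truncation
  -- order K suffices for it.
  have hν2 : ν = t * (b * (X + algebraMap ℂ A (F r : ℂ))) := by
    rw [← mul_assoc, ← hb, hν, Complex.ofReal_pow, map_pow]
    ring
  have hν0 : ν ^ K = 0 := by rw [hν2, mul_pow, ht, zero_mul]
  have hpos : 0 < F r ^ 2 := by positivity
  have hs : ContDiffAt ℝ ∞ Real.sqrt (F r ^ 2) := Real.contDiffAt_sqrt hpos.ne'
  refine eq_of_sq_eq_sq (c := F r) (by exact_mod_cast h0.ne') ?_ ?_ ?_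
  · obtain ⟨b', -, hb'⟩ := taylorAt_sub_algebraMap (t := ν) (K := K) (F := Real.sqrt)
      (r := F r ^ 2) hK
    rw [Real.sqrt_sq h0.le] at hb'
    rw [hb']
    exact ⟨K, by rw [mul_pow, hν0, zero_mul]⟩
  · exact ⟨K, by rw [hb, mul_pow, ht, zero_mul]⟩
  · have hid : Real.sqrt * Real.sqrt =ᶠ[nhds (F r ^ 2)] fun x => x := by
      filter_upwards [lt_mem_nhds hpos] with x hx
      exact Real.mul_self_sqrt hx.le
    rw [pow_two, taylorAt_mul hν0 hs hs, taylorAt_congr hid, taylorAt_id hν0 hK, hν]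
    ring

end TaylorExpansion

section OddCoordinates

variable {n m : ℕ}

/-! ### Odd coordinates and odd derivations -/

/-- The interior product with a linear functional on the span of the odd coordinates. -/
def contract (d : Module.Dual ℂ (Fin m ⊕ Fin m → ℂ)) : Grassmann m →ₗ[ℂ] Grassmann m :=
  CliffordAlgebra.contractLeft d

theorem contract_ι_mul (d : Module.Dual ℂ (Fin m ⊕ Fin m → ℂ)) (v : Fin m ⊕ Fin m → ℂ)
    (x : Grassmann m) :
    contract d (ExteriorAlgebra.ι ℂ v * x) = d v • x - ExteriorAlgebra.ι ℂ v * contract d x :=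
  CliffordAlgebra.contractLeft_ι_mul d v x

theorem contract_ι (d : Module.Dual ℂ (Fin m ⊕ Fin m → ℂ)) (v : Fin m ⊕ Fin m → ℂ) :
    contract d (ExteriorAlgebra.ι ℂ v) = algebraMap ℂ (Grassmann m) (d v) :=
  CliffordAlgebra.contractLeft_ι 0 d v

theorem contract_algebraMap (d : Module.Dual ℂ (Fin m ⊕ Fin m → ℂ)) (c : ℂ) :
    contract d (algebraMap ℂ (Grassmann m) c) = 0 :=
  CliffordAlgebra.contractLeft_algebraMap 0 d c

theorem contract_one (d : Module.Dual ℂ (Fin m ⊕ Fin m → ℂ)) :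
    contract d (1 : Grassmann m) = 0 :=
  CliffordAlgebra.contractLeft_one 0 d

theorem contract_ι_mul_ι_mul (d : Module.Dual ℂ (Fin m ⊕ Fin m → ℂ))
    (u v : Fin m ⊕ Fin m → ℂ) (x : Grassmann m) :
    contract d (ExteriorAlgebra.ι ℂ u * ExteriorAlgebra.ι ℂ v * x)
      = (d u • ExteriorAlgebra.ι ℂ v - d v • ExteriorAlgebra.ι ℂ u) * x
        + ExteriorAlgebra.ι ℂ u * ExteriorAlgebra.ι ℂ v * contract d x := by
  rw [mul_assoc, contract_ι_mul, contract_ι_mul, mul_sub, sub_mul, mul_smul_comm, smul_mul_assoc,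
    smul_mul_assoc, mul_assoc]
  abel

theorem contract_add (d d' : Module.Dual ℂ (Fin m ⊕ Fin m → ℂ)) (x : Grassmann m) :
    contract (d + d') x = contract d x + contract d' x := by
  simp [contract]

theorem contract_sub (d d' : Module.Dual ℂ (Fin m ⊕ Fin m → ℂ)) (x : Grassmann m) :
    contract (d - d') x = contract d x - contract d' x := by
  simp [contract]

theorem contract_smul (c : ℂ) (d : Module.Dual ℂ (Fin m ⊕ Fin m → ℂ)) (x : Grassmann m) :
    contract (c • d) x = c • contract d x := by
  simp [contract]

theorem oddDeriv_eq_contract (κ : Fin m ⊕ Fin m) :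
    oddDeriv κ = contract (LinearMap.proj κ) := rfl

/-- The vector of which `theta μ` is the image. -/
def thetaVec (μ : Fin m) : Fin m ⊕ Fin m → ℂ :=
  Pi.single (Sum.inl μ) 1 + Complex.I • Pi.single (Sum.inr μ) 1

/-- The vector of which `thetaBar μ` is the image. -/
def thetaBarVec (μ : Fin m) : Fin m ⊕ Fin m → ℂ :=
  Pi.single (Sum.inl μ) 1 - Complex.I • Pi.single (Sum.inr μ) 1

theorem theta_eq_ι (μ : Fin m) : theta μ = ExteriorAlgebra.ι ℂ (thetaVec μ) := by
  simp [theta, thetaVec, xi, eta]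

theorem thetaBar_eq_ι (μ : Fin m) : thetaBar μ = ExteriorAlgebra.ι ℂ (thetaBarVec μ) := by
  simp [thetaBar, thetaBarVec, xi, eta]

/-- The functional `½ (ξ^μ - i η^μ)`, dual to `θ^μ`. -/
def dualTheta (μ : Fin m) : Module.Dual ℂ (Fin m ⊕ Fin m → ℂ) :=
  (1 / 2 : ℂ) • ((LinearMap.proj (Sum.inl μ) : Module.Dual ℂ (Fin m ⊕ Fin m → ℂ))
    - Complex.I • (LinearMap.proj (Sum.inr μ) : Module.Dual ℂ (Fin m ⊕ Fin m → ℂ)))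

/-- The functional `½ (ξ^μ + i η^μ)`, dual to `θ̄^μ`. -/
def dualThetaBar (μ : Fin m) : Module.Dual ℂ (Fin m ⊕ Fin m → ℂ) :=
  (1 / 2 : ℂ) • ((LinearMap.proj (Sum.inl μ) : Module.Dual ℂ (Fin m ⊕ Fin m → ℂ))
    + Complex.I • (LinearMap.proj (Sum.inr μ) : Module.Dual ℂ (Fin m ⊕ Fin m → ℂ)))

theorem dualTheta_thetaVec (μ ν : Fin m) : dualTheta μ (thetaVec ν) = if μ = ν then 1 else 0 := by
  by_cases h : μ = ν
  · subst h
    simp [dualTheta, thetaVec]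
    norm_num
  · simp [dualTheta, thetaVec, h]

theorem dualTheta_thetaBarVec (μ ν : Fin m) : dualTheta μ (thetaBarVec ν) = 0 := by
  by_cases h : μ = ν
  · subst h
    simp [dualTheta, thetaBarVec]
  · simp [dualTheta, thetaBarVec, h]

theorem dualThetaBar_thetaBarVec (μ ν : Fin m) :
    dualThetaBar μ (thetaBarVec ν) = if μ = ν then 1 else 0 := by
  by_cases h : μ = ν
  · subst h
    simp [dualThetaBar, thetaBarVec]
    norm_num
  · simp [dualThetaBar, thetaBarVec, h]

theorem dualThetaBar_thetaVec (μ ν : Fin m) : dualThetaBar μ (thetaVec ν) = 0 := by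
  by_cases h : μ = ν
  · subst h
    simp [dualThetaBar, thetaVec]
  · simp [dualThetaBar, thetaVec, h]

theorem theta_mul_thetaBar (μ ν : Fin m) : theta μ * thetaBar ν = - (thetaBar ν * theta μ) := by
  rw [theta_eq_ι, thetaBar_eq_ι, ι_mul_ι_anticomm]

theorem theta_mul_theta (μ ν : Fin m) : theta μ * theta ν = - (theta ν * theta μ) := by
  rw [theta_eq_ι, theta_eq_ι, ι_mul_ι_anticomm]

theorem theta_mul_thetaBar_self (μ : Fin m) :
    Complex.I • (theta μ * thetaBar μ) = (2 : ℂ) • (xi μ * eta μ) := by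
  have h1 : xi μ * xi μ = (0 : Grassmann m) := ExteriorAlgebra.ι_sq_zero _
  have h2 : eta μ * eta μ = (0 : Grassmann m) := ExteriorAlgebra.ι_sq_zero _
  have h3 : eta μ * xi μ = -(xi μ * eta μ) := ι_mul_ι_anticomm _ _
  simp only [theta, thetaBar, add_mul, mul_sub, smul_mul_assoc, mul_smul_comm, h1, h2, h3]
  simp only [smul_zero, zero_add, add_zero, smul_neg, smul_sub, smul_smul,
    Complex.I_mul_I, two_smul, neg_smul, one_smul]
  abel

/-! ### The nilpotent part of the Hermitian square -/

theorem ι_mul_ι_mem_even (u v : Fin m ⊕ Fin m → ℂ) :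
    (ExteriorAlgebra.ι ℂ u * ExteriorAlgebra.ι ℂ v : Grassmann m) ∈ EvenGrassmann m :=
  CliffordAlgebra.ι_mul_ι_mem_evenOdd_zero _ _ _

theorem theta_mul_thetaBar_mem_even (μ ν : Fin m) : theta μ * thetaBar ν ∈ EvenGrassmann m := by
  rw [theta_eq_ι, thetaBar_eq_ι]
  exact ι_mul_ι_mem_even _ _

/-- The even element `θ^μ θ̄^ν`. -/
def thetaThetaBar (μ ν : Fin m) : EvenGrassmann m :=
  ⟨theta μ * thetaBar ν, theta_mul_thetaBar_mem_even μ ν⟩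

/-- The even nilpotent element `i ∑ θ^μ θ̄^μ`. -/
def tau (m : ℕ) : EvenGrassmann m := Complex.I • ∑ μ, thetaThetaBar μ μ

theorem coe_tau : (tau m : Grassmann m) = Complex.I • ∑ μ, theta μ * thetaBar μ := by
  simp [tau, thetaThetaBar]

theorem coe_tau_eq_sum : (tau m : Grassmann m) = ∑ μ, (2 : ℂ) • (xi μ * eta μ) := by
  rw [coe_tau, Finset.smul_sum]
  exact Finset.sum_congr rfl fun μ _ => theta_mul_thetaBar_self μ

/-- A sum of m commuting elements of square zero: each θ^μ θ̄^μ contains θ^μ, which squares to zero.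
-/
theorem tau_pow_succ : tau m ^ (m + 1) = 0 := by
  have key : ∀ s : Finset (Fin m), (∑ μ ∈ s, thetaThetaBar μ μ) ^ (s.card + 1) = 0 := by
    intro s
    induction s using Finset.induction_on with
    | empty => simp
    | insert μ s hμ ih =>
      rw [Finset.sum_insert hμ, Finset.card_insert_of_notMem hμ]
      refine (Commute.all _ _).add_pow_eq_zero_of_add_le_succ_of_pow_eq_zero (m := 2) ?_ ih
        (by omega)
      apply Subtype.ext
      change (theta μ * thetaBar μ) ^ 2 = 0
      have : theta μ * theta μ = 0 := by rw [theta_eq_ι]; exact ExteriorAlgebra.ι_sq_zero _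
      rw [pow_two, mul_assoc, ← mul_assoc (thetaBar μ), ← neg_eq_iff_eq_neg.mpr
        (theta_mul_thetaBar μ μ), neg_mul, mul_neg, ← mul_assoc, ← mul_assoc, this]
      simp
  have := key Finset.univ
  rw [Finset.card_univ, Fintype.card_fin] at this
  rw [tau, smul_pow, this, smul_zero]

/-- This is the truncation order built into `superEval`, coarser than necessary for τ. -/
theorem tau_pow_two_mul_add_one : tau m ^ (2 * m + 1) = 0 :=
  pow_eq_zero_of_le (by omega) tau_pow_succ

/-- The value at `r + τ` of a function `F`, as an even element. -/
def evalTau (m : ℕ) (F : ℝ → ℝ) (r : ℝ) : EvenGrassmann m := taylorAt (tau m) (2 * m + 1) F r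

theorem coe_evalTau (F : ℝ → ℝ) (r : ℝ) :
    (evalTau m F r : Grassmann m) = taylorAt (tau m : Grassmann m) (2 * m + 1) F r :=
  map_taylorAt (EvenGrassmann m).val

theorem body_ι (v : Fin m ⊕ Fin m → ℂ) : body (ExteriorAlgebra.ι ℂ v : Grassmann m) = 0 := by
  simp [body, ExteriorAlgebra.algebraMapInv]

theorem body_algebraMap (c : ℂ) : body (algebraMap ℂ (Grassmann m) c) = c :=
  ExteriorAlgebra.algebraMap_leftInverse _ c

theorem body_tau : body (tau m : Grassmann m) = 0 := by
  rw [coe_tau, map_smul, map_sum]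
  simp [theta_eq_ι, body_ι]

theorem body_evalTau (F : ℝ → ℝ) (r : ℝ) : body (evalTau m F r : Grassmann m) = F r := by
  rw [coe_evalTau, map_taylorAt, body_tau, taylorAt_zero (by omega)]
  rfl

theorem superEval_eq_taylorAt (F : ℝ → ℝ) (a : Grassmann m) :
    superEval F a
      = taylorAt (a - algebraMap ℂ (Grassmann m) (body a)) (2 * m + 1) F (body a).re := rfl

theorem superEval_algebraMap_add_tau (F : ℝ → ℝ) (r : ℝ) :
    superEval F (algebraMap ℂ (Grassmann m) r + (tau m : Grassmann m))
      = (evalTau m F r : Grassmann m) := by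
  rw [superEval_eq_taylorAt, map_add, body_algebraMap, body_tau, add_zero, add_sub_cancel_left,
    Complex.ofReal_re, coe_evalTau]

/-- The square root with positive body of the square of the value at `r + τ` of a function positive
at `r`. -/
theorem superEval_sqrt_sq {F : ℝ → ℝ} {r : ℝ} (h0 : 0 < F r) :
    superEval Real.sqrt ((evalTau m F r ^ 2 : EvenGrassmann m) : Grassmann m)
      = (evalTau m F r : Grassmann m) := by
  have hb : body ((evalTau m F r ^ 2 : EvenGrassmann m) : Grassmann m) = ((F r ^ 2 : ℝ) : ℂ) := by
    rw [SubmonoidClass.coe_pow, map_pow, body_evalTau, Complex.ofReal_pow]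
  have h := congrArg (EvenGrassmann m).val
    (taylorAt_sqrt_sq (tau_pow_two_mul_add_one (m := m)) (Nat.succ_pos _) h0)
  rw [map_taylorAt, map_sub, AlgHom.commutes] at h
  rw [superEval_eq_taylorAt, hb, Complex.ofReal_re]
  exact h

theorem evalTau_mul {F G : ℝ → ℝ} {r : ℝ} (hF : ContDiffAt ℝ ∞ F r) (hG : ContDiffAt ℝ ∞ G r) :
    evalTau m F r * evalTau m G r = evalTau m (F * G) r :=
  taylorAt_mul tau_pow_two_mul_add_one hF hG

theorem evalTau_id (r : ℝ) :
    evalTau m (fun x => x) r = algebraMap ℂ (EvenGrassmann m) r + tau m :=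
  taylorAt_id tau_pow_two_mul_add_one (by omega)

/-- The odd derivative of the value at `r + τ` of a function. -/
theorem contract_evalTau (d : Module.Dual ℂ (Fin m ⊕ Fin m → ℂ)) (F : ℝ → ℝ) (r : ℝ) :
    contract d (evalTau m F r : Grassmann m)
      = evalTau m (deriv F) r * contract d (tau m : Grassmann m) := by
  -- As τ is even, the odd derivation obeys the Leibniz rule without a sign when it passes τ.
  have hmul : ∀ x, contract d ((tau m : Grassmann m) * x)
      = contract d (tau m : Grassmann m) * x + tau m * contract d x := by
    intro x
    simp only [coe_tau, Finset.smul_sum, Finset.sum_mul, map_sum, smul_mul_assoc, map_smul,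
      theta_eq_ι, thetaBar_eq_ι, contract_ι_mul_ι_mul, ← Finset.sum_add_distrib, ← smul_add]
    refine Finset.sum_congr rfl fun μ _ => ?_
    rw [contract_ι_mul, contract_ι, sub_mul, ← Algebra.commutes (d (thetaBarVec μ)), sub_mul,
      ← Algebra.smul_def]
  have hpow : ∀ j : ℕ, contract d ((tau m : Grassmann m) ^ j)
      = (j : ℂ) • ((tau m : Grassmann m) ^ (j - 1) * contract d (tau m : Grassmann m)) := by
    intro j
    induction j with
    | zero => simp [contract_one]
    | succ j ih =>
      have hc : contract d (tau m : Grassmann m) * (tau m : Grassmann m) ^ j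
          = (tau m : Grassmann m) ^ j * contract d (tau m : Grassmann m) := by
        rw [even_commute (pow_mem (tau m).2 j)]
      rw [pow_succ', hmul, ih, hc, Nat.add_sub_cancel, mul_smul_comm, ← mul_assoc, ← pow_succ']
      rcases j with _ | j
      · simp
      · rw [Nat.add_sub_cancel, Nat.cast_succ (j + 1), add_smul, one_smul, add_comm]
  -- Differentiation lowers the truncation order by one, so the last term τ^{2m} on the right must
  -- vanish. This needs m + 1 ≤ 2m, which fails only for m = 0, where there are no odd functionals.
  rcases Nat.eq_zero_or_pos m with rfl | hm
  · have : d = 0 := by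
      ext v
      exact v.elim (fun i => i.elim0) (fun i => i.elim0)
    subst this
    simp [contract]
  have htop : (tau m : Grassmann m) ^ (2 * m) = 0 := by
    have h := congrArg (Subtype.val) (pow_eq_zero_of_le (show m + 1 ≤ 2 * m by omega)
      (tau_pow_succ (m := m)))
    simpa using h
  rw [coe_evalTau, coe_evalTau]
  unfold taylorAt
  rw [map_sum, Finset.sum_range_succ', Finset.sum_range_succ _ (2 * m), htop]
  simp only [map_smul, pow_zero, contract_one, smul_zero, add_zero, Finset.sum_mul]
  refine Finset.sum_congr rfl fun j _ => ?_
  rw [hpow, Nat.add_sub_cancel, smul_smul, smul_mul_assoc, ← iteratedDeriv_succ']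
  congr 1
  have := Nat.factorial_ne_zero j
  rw [Nat.factorial_succ]
  push_cast
  have h1 : (j : ℂ) + 1 ≠ 0 := Nat.cast_add_one_ne_zero j
  field_simp

theorem contract_dualTheta_tau (μ : Fin m) :
    contract (dualTheta μ) (tau m : Grassmann m) = Complex.I • thetaBar μ := by
  rw [coe_tau, map_smul, map_sum, Finset.sum_eq_single μ]
  · rw [theta_eq_ι, thetaBar_eq_ι, contract_ι_mul, contract_ι, dualTheta_thetaVec,
      dualTheta_thetaBarVec]
    simp
  · intro ν _ h
    rw [theta_eq_ι, thetaBar_eq_ι, contract_ι_mul, contract_ι, dualTheta_thetaVec,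
      dualTheta_thetaBarVec]
    simp [h.symm]
  · simp

theorem contract_dualThetaBar_tau (μ : Fin m) :
    contract (dualThetaBar μ) (tau m : Grassmann m) = -(Complex.I • theta μ) := by
  rw [coe_tau, map_smul, map_sum, Finset.sum_eq_single μ]
  · rw [theta_eq_ι, thetaBar_eq_ι, contract_ι_mul, contract_ι, dualThetaBar_thetaVec,
      dualThetaBar_thetaBarVec]
    simp
  · intro ν _ h
    rw [theta_eq_ι, thetaBar_eq_ι, contract_ι_mul, contract_ι, dualThetaBar_thetaVec,
      dualThetaBar_thetaBarVec]
    simp [h.symm]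
  · simp

end OddCoordinates

section OddIntegral

variable {n m : ℕ}

/-! ### The odd integral -/

/-- The iterated odd derivative `∂_{ξ^{μ₁}} ∂_{η^{μ₁}} ∂_{ξ^{μ₂}} ⋯` along a list of indices. -/
def iteratedOddDeriv (l : List (Fin m)) : Grassmann m →ₗ[ℂ] Grassmann m :=
  l.foldr (fun μ g => oddDeriv (Sum.inl μ) ∘ₗ oddDeriv (Sum.inr μ) ∘ₗ g) LinearMap.id

theorem oddIntegral_apply (x : Grassmann m) :
    oddIntegral x = body (iteratedOddDeriv (List.finRange m) x) := rfl

theorem iteratedOddDeriv_cons (μ : Fin m) (l : List (Fin m)) (x : Grassmann m) :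
    iteratedOddDeriv (μ :: l) x
      = oddDeriv (Sum.inl μ) (oddDeriv (Sum.inr μ) (iteratedOddDeriv l x)) := rfl

theorem iteratedOddDeriv_append (l l' : List (Fin m)) (x : Grassmann m) :
    iteratedOddDeriv (l ++ l') x = iteratedOddDeriv l (iteratedOddDeriv l' x) := by
  induction l with
  | nil => rfl
  | cons μ l ih => rw [List.cons_append, iteratedOddDeriv_cons, ih, iteratedOddDeriv_cons]

/-- The chain rule for a linear substitution of the odd coordinates. -/
theorem contract_map (d : Module.Dual ℂ (Fin m ⊕ Fin m → ℂ))
    (f : (Fin m ⊕ Fin m → ℂ) →ₗ[ℂ] (Fin m ⊕ Fin m → ℂ)) (x : Grassmann m) :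
    contract d (ExteriorAlgebra.map f x) = ExteriorAlgebra.map f (contract (d ∘ₗ f) x) := by
  induction x using CliffordAlgebra.left_induction with
  | algebraMap c =>
    change contract d (ExteriorAlgebra.map f (algebraMap ℂ (Grassmann m) c))
      = ExteriorAlgebra.map f (contract (d ∘ₗ f) (algebraMap ℂ (Grassmann m) c))
    rw [AlgHom.commutes, contract_algebraMap, contract_algebraMap, map_zero]
  | add x y hx hy => simp only [map_add, hx, hy]
  | ι_mul x v hx =>
    change contract d (ExteriorAlgebra.map f (ExteriorAlgebra.ι ℂ v * x))
      = ExteriorAlgebra.map f (contract (d ∘ₗ f) (ExteriorAlgebra.ι ℂ v * x))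
    rw [map_mul, ExteriorAlgebra.map_apply_ι, contract_ι_mul, hx, contract_ι_mul, map_sub, map_smul,
      map_mul, ExteriorAlgebra.map_apply_ι]
    rfl

theorem contract_contract (d : Module.Dual ℂ (Fin m ⊕ Fin m → ℂ)) (x : Grassmann m) :
    contract d (contract d x) = 0 :=
  CliffordAlgebra.contractLeft_contractLeft d x

theorem contract_comm (d d' : Module.Dual ℂ (Fin m ⊕ Fin m → ℂ)) (x : Grassmann m) :
    contract d (contract d' x) = -contract d' (contract d x) :=
  CliffordAlgebra.contractLeft_comm d d' x

/-- Multiplication by c acts on the plane of ξ^μ, η^μ with determinant |c|², and the pair of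
anticommuting derivatives picks up this determinant. -/
theorem oddDeriv_oddDeriv_oddScale (c : ℂ) (μ : Fin m) (x : Grassmann m) :
    oddDeriv (Sum.inl μ) (oddDeriv (Sum.inr μ) (oddScale c x))
      = (Complex.normSq c : ℂ) •
        oddScale c (oddDeriv (Sum.inl μ) (oddDeriv (Sum.inr μ) x)) := by
  simp only [oddDeriv_eq_contract, oddScale, contract_map]
  set L := (Pi.basisFun ℂ (Fin m ⊕ Fin m)).constr ℂ (Sum.elim
    (fun μ => (c.re : ℂ) • Pi.single (Sum.inl μ) 1 - (c.im : ℂ) • Pi.single (Sum.inr μ) 1)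
    (fun μ => (c.im : ℂ) • Pi.single (Sum.inl μ) 1 + (c.re : ℂ) • Pi.single (Sum.inr μ) 1))
    with hL
  have hLi : ∀ κ, L (Pi.single κ 1) = Sum.elim
    (fun μ => (c.re : ℂ) • Pi.single (Sum.inl μ) 1 - (c.im : ℂ) • Pi.single (Sum.inr μ) 1)
    (fun μ => (c.im : ℂ) • Pi.single (Sum.inl μ) 1 + (c.re : ℂ) • Pi.single (Sum.inr μ) 1) κ := by
    intro κ
    have := (Pi.basisFun ℂ (Fin m ⊕ Fin m)).constr_basis ℂ (Sum.elim
    (fun μ => (c.re : ℂ) • Pi.single (Sum.inl μ) 1 - (c.im : ℂ) • Pi.single (Sum.inr μ) 1)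
    (fun μ => (c.im : ℂ) • Pi.single (Sum.inl μ) 1 + (c.re : ℂ) • Pi.single (Sum.inr μ) 1)) κ
    rwa [Pi.basisFun_apply] at this
  have h1 : (LinearMap.proj (Sum.inl μ) : Module.Dual ℂ (Fin m ⊕ Fin m → ℂ)) ∘ₗ L
      = (c.re : ℂ) • (LinearMap.proj (Sum.inl μ) : Module.Dual ℂ (Fin m ⊕ Fin m → ℂ))
        + (c.im : ℂ) • (LinearMap.proj (Sum.inr μ) : Module.Dual ℂ (Fin m ⊕ Fin m → ℂ)) := by
    refine (Pi.basisFun ℂ (Fin m ⊕ Fin m)).ext fun κ => ?_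
    rw [Pi.basisFun_apply, LinearMap.comp_apply, hLi]
    rcases κ with κ | κ <;> by_cases h : μ = κ <;> simp [h]
  have h2 : (LinearMap.proj (Sum.inr μ) : Module.Dual ℂ (Fin m ⊕ Fin m → ℂ)) ∘ₗ L
      = (c.re : ℂ) • (LinearMap.proj (Sum.inr μ) : Module.Dual ℂ (Fin m ⊕ Fin m → ℂ))
        - (c.im : ℂ) • (LinearMap.proj (Sum.inl μ) : Module.Dual ℂ (Fin m ⊕ Fin m → ℂ)) := by
    refine (Pi.basisFun ℂ (Fin m ⊕ Fin m)).ext fun κ => ?_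
    rw [Pi.basisFun_apply, LinearMap.comp_apply, hLi]
    rcases κ with κ | κ <;> by_cases h : μ = κ <;> simp [h]
  rw [h1, h2, ← map_smul]
  congr 1
  simp only [contract_add, contract_sub, contract_smul, map_sub, map_smul, contract_contract]
  rw [contract_comm (LinearMap.proj (Sum.inr μ)) (LinearMap.proj (Sum.inl μ))]
  simp only [smul_zero, smul_neg, Complex.normSq_apply, Complex.ofReal_add, Complex.ofReal_mul,
    add_smul]
  module

theorem body_oddScale (c : ℂ) (x : Grassmann m) : body (oddScale c x) = body x := by
  have : (body.comp (oddScale c) : Grassmann m →ₐ[ℂ] ℂ) = body := by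
    ext v
    simp [oddScale, body_ι]
  exact DFunLike.congr_fun this x

/-- The substitution rule for the odd integral. -/
theorem oddIntegral_oddScale (c : ℂ) (x : Grassmann m) :
    oddIntegral (oddScale c x) = (Complex.normSq c : ℂ) ^ m * oddIntegral x := by
  have key : ∀ l : List (Fin m), iteratedOddDeriv l (oddScale c x)
      = (Complex.normSq c : ℂ) ^ l.length • oddScale c (iteratedOddDeriv l x) := by
    intro l
    induction l with
    | nil => simp [iteratedOddDeriv]
    | cons μ l ih =>
      rw [iteratedOddDeriv_cons, ih, map_smul, map_smul, oddDeriv_oddDeriv_oddScale, smul_smul,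
        iteratedOddDeriv_cons, List.length_cons, pow_succ]
  rw [oddIntegral_apply, key, map_smul, body_oddScale, oddIntegral_apply, List.length_finRange,
    smul_eq_mul]

theorem oddScale_xi (c : ℂ) (μ : Fin m) :
    oddScale c (xi μ) = (c.re : ℂ) • xi μ - (c.im : ℂ) • (eta μ : Grassmann m) := by
  rw [oddScale, xi, ExteriorAlgebra.map_apply_ι, ← Pi.basisFun_apply, Module.Basis.constr_basis]
  simp only [Sum.elim_inl, map_sub, map_smul, Pi.basisFun_apply]
  rfl

theorem oddScale_eta (c : ℂ) (μ : Fin m) :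
    oddScale c (eta μ) = (c.im : ℂ) • xi μ + (c.re : ℂ) • (eta μ : Grassmann m) := by
  rw [oddScale, eta, ExteriorAlgebra.map_apply_ι, ← Pi.basisFun_apply, Module.Basis.constr_basis]
  simp only [Sum.elim_inr, map_add, map_smul, Pi.basisFun_apply]
  rfl

/-- The odd counterpart of `bodySq_transition`: together they make N scale by |c|² under a change of
chart. -/
theorem oddScale_tau (c : ℂ) :
    oddScale c (tau m : Grassmann m) = (Complex.normSq c : ℂ) • (tau m : Grassmann m) := by
  rw [coe_tau_eq_sum, map_sum, Finset.smul_sum]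
  refine Finset.sum_congr rfl fun μ _ => ?_
  have h1 : xi μ * xi μ = (0 : Grassmann m) := ExteriorAlgebra.ι_sq_zero _
  have h2 : eta μ * eta μ = (0 : Grassmann m) := ExteriorAlgebra.ι_sq_zero _
  have h3 : eta μ * xi μ = -(xi μ * eta μ) := ι_mul_ι_anticomm _ _
  rw [map_smul, map_mul, oddScale_xi, oddScale_eta]
  simp only [sub_mul, mul_add, smul_mul_assoc, mul_smul_comm, h1, h2, h3, Complex.normSq_apply,
    Complex.ofReal_add, Complex.ofReal_mul, smul_zero]
  module

/-- The factor ξ^μ η^μ is even and does not involve the variables of the list, so every derivative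
passes through it without a sign. -/
theorem iteratedOddDeriv_xi_mul_eta_mul {l : List (Fin m)} {μ : Fin m} (hμ : μ ∉ l)
    (x : Grassmann m) :
    iteratedOddDeriv l (xi μ * eta μ * x) = xi μ * eta μ * iteratedOddDeriv l x := by
  induction l with
  | nil => rfl
  | cons ν l ih =>
    rw [List.mem_cons, not_or] at hμ
    rw [iteratedOddDeriv_cons, ih hμ.2, iteratedOddDeriv_cons]
    have h : ∀ (d : Module.Dual ℂ (Fin m ⊕ Fin m → ℂ)) (y : Grassmann m),
        d (Pi.single (Sum.inl μ) 1) = 0 → d (Pi.single (Sum.inr μ) 1) = 0 →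
        contract d (xi μ * eta μ * y) = xi μ * eta μ * contract d y := by
      intro d y h1 h2
      rw [xi, eta, contract_ι_mul_ι_mul, h1, h2]
      simp
    rw [oddDeriv_eq_contract, oddDeriv_eq_contract, h, h] <;> simp [Ne.symm hμ.1]

theorem contract_proj_inl_tau (μ : Fin m) :
    contract (LinearMap.proj (Sum.inl μ)) (tau m : Grassmann m) = (2 : ℂ) • eta μ := by
  rw [coe_tau_eq_sum, map_sum, Finset.sum_eq_single μ]
  · rw [map_smul, xi, eta, contract_ι_mul, contract_ι]
    simp
  · intro ν _ h
    rw [map_smul, xi, eta, contract_ι_mul, contract_ι]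
    simp [h.symm]
  · simp

theorem contract_proj_inr_tau (μ : Fin m) :
    contract (LinearMap.proj (Sum.inr μ)) (tau m : Grassmann m) = -((2 : ℂ) • xi μ) := by
  rw [coe_tau_eq_sum, map_sum, Finset.sum_eq_single μ]
  · rw [map_smul, xi, eta, contract_ι_mul, contract_ι]
    simp
  · intro ν _ h
    rw [map_smul, xi, eta, contract_ι_mul, contract_ι]
    simp [h.symm]
  · simp

/-- The chain rule applied twice. The term with F'' retains ξ^μ η^μ, so it has no body after
derivatives in the other variables; only -2 F' contributes to the odd integral. -/
theorem oddDeriv_oddDeriv_evalTau (μ : Fin m) (F : ℝ → ℝ) (r : ℝ) :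
    oddDeriv (Sum.inl μ) (oddDeriv (Sum.inr μ) (evalTau m F r : Grassmann m))
      = (-2 : ℂ) • (evalTau m (deriv F) r : Grassmann m)
        + xi μ * eta μ * ((4 : ℂ) • (evalTau m (deriv (deriv F)) r : Grassmann m)) := by
  rw [oddDeriv_eq_contract, oddDeriv_eq_contract, contract_evalTau, contract_proj_inr_tau,
    even_commute (evalTau m (deriv F) r).2, neg_mul, smul_mul_assoc, map_neg, map_smul]
  rw [show contract (LinearMap.proj (Sum.inl μ)) (xi μ * (evalTau m (deriv F) r : Grassmann m))
    = (evalTau m (deriv F) r : Grassmann m) - xi μ * contract (LinearMap.proj (Sum.inl μ))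
      (evalTau m (deriv F) r : Grassmann m) by rw [xi, contract_ι_mul]; simp]
  rw [contract_evalTau, contract_proj_inl_tau, even_commute (evalTau m (deriv (deriv F)) r).2]
  simp only [smul_mul_assoc, mul_smul_comm, mul_assoc]
  module

theorem body_iteratedOddDeriv_evalTau {l : List (Fin m)} (hl : l.Nodup) (F : ℝ → ℝ) (r : ℝ) :
    body (iteratedOddDeriv l (evalTau m F r : Grassmann m))
      = (-2 : ℂ) ^ l.length * (iteratedDeriv l.length F r : ℝ) := by
  -- The last entry of the list acts first on the function, so the list is peeled from the right and
  -- F is replaced by F'.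
  induction l using List.reverseRecOn generalizing F with
  | nil => simpa [iteratedOddDeriv] using body_evalTau F r
  | append_singleton l μ ih =>
    rw [List.nodup_append] at hl
    have hμ : μ ∉ l := fun h => hl.2.2 μ h μ (by simp) rfl
    rw [iteratedOddDeriv_append]
    change body (iteratedOddDeriv l (oddDeriv (Sum.inl μ) (oddDeriv (Sum.inr μ)
      (evalTau m F r : Grassmann m)))) = _
    rw [oddDeriv_oddDeriv_evalTau, map_add, map_smul, iteratedOddDeriv_xi_mul_eta_mul hμ, map_add,
      map_smul, ih hl.1, map_mul, map_mul, xi, body_ι, zero_mul, zero_mul, add_zero,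
      List.length_append, List.length_singleton, iteratedDeriv_succ', pow_succ, smul_eq_mul]
    ring

/-- Since τ = 2 ∑ ξ^μ η^μ, the top coefficient of F(r + τ) is 2^m F^{(m)}(r); the sign (-1)^m comes
from the normalization on η^μ ξ^μ rather than ξ^μ η^μ. -/
theorem oddIntegral_evalTau (F : ℝ → ℝ) (r : ℝ) :
    oddIntegral (evalTau m F r : Grassmann m) = (-2 : ℂ) ^ m * (iteratedDeriv m F r : ℝ) := by
  rw [oddIntegral_apply, body_iteratedOddDeriv_evalTau (List.nodup_finRange m),
    List.length_finRange]

/-! ### The Gamma factor -/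

/-- After absorbing the signs this is the product (n-m+1)⋯n. It equals n!/(n-m)! for m ≤ n and
contains a zero factor for m > n; in the latter case the right side is a division by `Real.Gamma` at
a pole, where its value is 0. -/
theorem prod_range_sub_eq (n m : ℕ) :
    (-1 : ℝ) ^ m * ∏ i ∈ Finset.range m, ((((m : ℤ) - n - 1 : ℤ) : ℝ) - i)
      = n.factorial / Real.Gamma ((n : ℝ) - m + 1) := by
  have h1 : (-1 : ℝ) ^ m * ∏ i ∈ Finset.range m, ((((m : ℤ) - n - 1 : ℤ) : ℝ) - i)
      = ∏ i ∈ Finset.range m, ((n : ℝ) - m + 1 + i) := by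
    rw [← Finset.card_range m, ← Finset.prod_const, Finset.card_range, ← Finset.prod_mul_distrib]
    refine Finset.prod_congr rfl fun i _ => ?_
    push_cast
    ring
  rw [h1]
  rcases le_or_gt m n with h | h
  · obtain ⟨k, rfl⟩ := Nat.exists_eq_add_of_le' h
    have h2 : ((k + m : ℕ) : ℝ) - m + 1 = (k : ℝ) + 1 := by push_cast; ring
    rw [h2, Real.Gamma_nat_eq_factorial, ← Nat.factorial_mul_ascFactorial k m,
      Nat.ascFactorial_eq_prod_range]
    have := Nat.factorial_ne_zero k
    push_cast
    field_simp
  · obtain ⟨k, rfl⟩ := Nat.exists_eq_add_of_lt h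
    have h2 : (n : ℝ) - (n + k + 1 : ℕ) + 1 = -(k : ℝ) := by push_cast; ring
    rw [h2, Real.Gamma_neg_nat_eq_zero, div_zero]
    refine Finset.prod_eq_zero (Finset.mem_range.mpr (show k < n + k + 1 by omega)) ?_
    ring

/-- The m-th derivative of x^{m-n-1} is a multiple of x^{-n-1}, so the weight r^{n+1} leaves a
constant, independent of the point. -/
theorem pow_mul_oddIntegral_evalTau_zpow (n m : ℕ) {r : ℝ} (hr : 0 < r) :
    ((r ^ (n + 1) : ℝ) : ℂ) *
      oddIntegral (evalTau m (fun x => x ^ ((m : ℤ) - n - 1)) r : Grassmann m)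
      = ((2 ^ m * n.factorial / Real.Gamma ((n : ℝ) - m + 1) : ℝ) : ℂ) := by
  rw [oddIntegral_evalTau, iteratedDeriv_eq_iterate, iter_deriv_zpow, mul_div_assoc,
    ← prod_range_sub_eq, show (m : ℤ) - n - 1 - m = -((n + 1 : ℕ) : ℤ) by push_cast; ring,
    zpow_neg, zpow_natCast]
  have : r ^ (n + 1) ≠ 0 := by positivity
  rw [show ((-2 : ℂ)) ^ m = (((-1) ^ m * 2 ^ m : ℝ) : ℂ) by push_cast; rw [← mul_pow]; norm_num,
    ← Complex.ofReal_mul, ← Complex.ofReal_mul]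
  congr 1
  field_simp

end OddIntegral

section HermitianSquare

variable {n m : ℕ}

/-! ### Derivatives of functions of the Hermitian square -/

/-- The body `1 + ∑ |w^a|²` of the Hermitian square. -/
def bodySq (w : Fin n → ℂ) : ℝ := 1 + ∑ a, Complex.normSq (w a)

theorem bodySq_pos (w : Fin n → ℂ) : 0 < bodySq w :=
  add_pos_of_pos_of_nonneg one_pos (Finset.sum_nonneg fun _ _ => Complex.normSq_nonneg _)

theorem sum_homog (k : Fin (n + 1)) (w : Fin n → ℂ) :
    ∑ a, homog k w a * star (homog k w a) = (bodySq w : ℂ) := by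
  rw [Fin.sum_univ_succAbove _ k]
  simp [homog, bodySq, Complex.mul_conj]

theorem hermSq_eq (k : Fin (n + 1)) (w : Fin n → ℂ) :
    hermSq k w = algebraMap ℂ (Grassmann m) (bodySq w) + (tau m : Grassmann m) := by
  rw [hermSq, sum_homog, coe_tau]

/-- A Grassmann-valued function has a derivative in a real direction, in terms of a finite expansion
with constant Grassmann coefficients. -/
def HasEvenDerivAt (f : ChartFun n m) (f' : Grassmann m) (v w : Fin n → ℂ) : Prop :=
  ∀ φ : Grassmann m →ₗ[ℂ] ℂ, HasLineDerivAt ℝ (fun u => φ (f u)) (φ f') w v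

theorem HasEvenDerivAt.evenDeriv {f : ChartFun n m} {f' : Grassmann m} {v w : Fin n → ℂ}
    (h : HasEvenDerivAt f f' v w) : evenDeriv v f w = f' := by
  rw [SuperCP.evenDeriv, ← (monomials m).sum_repr f']
  refine Finset.sum_congr rfl fun s _ => ?_
  congr 1
  exact (h ((monomials m).coord s)).lineDeriv

theorem HasEvenDerivAt.mul_const {f : ChartFun n m} {f' : Grassmann m} {v w : Fin n → ℂ}
    (h : HasEvenDerivAt f f' v w) (g : Grassmann m) :
    HasEvenDerivAt (fun u => f u * g) (f' * g) v w := fun φ =>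
  h (φ ∘ₗ LinearMap.mulRight ℂ g)

theorem hasLineDerivAt_bodySq (v w : Fin n → ℂ) :
    HasLineDerivAt ℝ (bodySq : (Fin n → ℂ) → ℝ) (∑ a, 2 * (star (w a) * v a).re) w v := by
  unfold HasLineDerivAt bodySq
  refine HasDerivAt.const_add _ (HasDerivAt.fun_sum fun a _ => ?_)
  simp only [Complex.normSq_apply, Pi.add_apply, Pi.smul_apply, Complex.add_re, Complex.add_im,
    Complex.real_smul, Complex.mul_re, Complex.mul_im, Complex.ofReal_re, Complex.ofReal_im,
    zero_mul, sub_zero, add_zero]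
  have h1 : HasDerivAt (fun t : ℝ => (w a).re + t * (v a).re) (v a).re 0 := by
    simpa using ((hasDerivAt_id (0 : ℝ)).mul_const (v a).re).const_add (w a).re
  have h2 : HasDerivAt (fun t : ℝ => (w a).im + t * (v a).im) (v a).im 0 := by
    simpa using ((hasDerivAt_id (0 : ℝ)).mul_const (v a).im).const_add (w a).im
  refine ((h1.mul h1).add (h2.mul h2)).congr_deriv ?_
  simp
  ring

theorem contDiffAt_iteratedDeriv {F : ℝ → ℝ} {x : ℝ} (hF : ContDiffAt ℝ ∞ F x) (j : ℕ) :
    ContDiffAt ℝ ∞ (iteratedDeriv j F) x := by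
  rw [iteratedDeriv_eq_equiv_comp]
  exact (LinearIsometryEquiv.contDiff _).contDiffAt.comp x
    (hF.iteratedFDeriv_right (m := ∞) (i := j) (by exact_mod_cast le_top))

theorem hasEvenDerivAt_evalTau {F : ℝ → ℝ} (v w : Fin n → ℂ)
    (hF : ContDiffAt ℝ ∞ F (bodySq w)) :
    HasEvenDerivAt (fun u => (evalTau m F (bodySq u) : Grassmann m))
      (((∑ a, 2 * (star (w a) * v a).re : ℝ) : ℂ) • (evalTau m (deriv F) (bodySq w) : Grassmann m))
      v w := by
  intro φ
  simp only [coe_evalTau, taylorAt, map_sum, map_smul, Finset.smul_sum]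
  unfold HasLineDerivAt
  refine HasDerivAt.fun_sum fun j _ => ?_
  have h1 : HasDerivAt (iteratedDeriv j F) (iteratedDeriv j (deriv F) (bodySq w)) (bodySq w) := by
    rw [← iteratedDeriv_succ', iteratedDeriv_succ]
    exact (contDiffAt_iteratedDeriv hF j).differentiableAt (by simp) |>.hasDerivAt
  have h2 := (hasLineDerivAt_bodySq v w)
  unfold HasLineDerivAt at h2
  have h0 : bodySq w = bodySq (w + (0 : ℝ) • v) := by simp
  rw [h0] at h1
  have h3 := ((h1.comp (0 : ℝ) h2).div_const (j.factorial : ℝ)).ofReal_comp.smul_const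
    (φ ((tau m : Grassmann m) ^ j))
  refine h3.congr_deriv ?_
  rw [← h0, smul_smul, ← Complex.ofReal_mul]
  congr 2
  ring

theorem hasEvenDerivAt_smul_evalTau {F : ℝ → ℝ} (v w : Fin n → ℂ) (a : Fin n)
    (hF : ContDiffAt ℝ ∞ F (bodySq w)) :
    HasEvenDerivAt (fun u => u a • (evalTau m F (bodySq u) : Grassmann m))
      (v a • (evalTau m F (bodySq w) : Grassmann m) + w a •
      ((∑ a, 2 * (star (w a) * v a).re : ℝ) : ℂ) • (evalTau m (deriv F) (bodySq w) : Grassmann m))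
      v w := by
  intro φ
  have h1 := hasEvenDerivAt_evalTau (m := m) v w hF φ
  simp only [map_smul, map_add]
  unfold HasLineDerivAt at h1 ⊢
  have h2 : HasDerivAt (fun t : ℝ => (w + t • v) a) (v a) 0 := by
    simpa using ((hasDerivAt_id (0 : ℝ)).ofReal_comp.mul_const (v a)).const_add (w a)
  refine (h2.smul h1).congr_deriv ?_
  simp
  ring

/-- The derivatives `∂_a` of functions of `r + τ`, `r = bodySq w`. -/
theorem dHol_inl_eq {f : ChartFun n m} {w : Fin n → ℂ} {a : Fin n} {x y : Grassmann m}
    (hx : HasEvenDerivAt f x (Pi.single a 1) w) (hy : HasEvenDerivAt f y (Pi.single a Complex.I) w) :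
    dHol (Sum.inl a) f w = (1 / 2 : ℂ) • (x - Complex.I • y) := by
  simp only [dHol, derivRe, derivIm, Pi.smul_apply, Pi.sub_apply, hx.evenDeriv, hy.evenDeriv]

theorem dBar_inl_eq {f : ChartFun n m} {w : Fin n → ℂ} {a : Fin n} {x y : Grassmann m}
    (hx : HasEvenDerivAt f x (Pi.single a 1) w) (hy : HasEvenDerivAt f y (Pi.single a Complex.I) w) :
    dBar (Sum.inl a) f w = (1 / 2 : ℂ) • (x + Complex.I • y) := by
  simp only [dBar, derivRe, derivIm, Pi.smul_apply, Pi.add_apply, hx.evenDeriv, hy.evenDeriv]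

theorem dHol_inr_eq (f : ChartFun n m) (w : Fin n → ℂ) (μ : Fin m) :
    dHol (Sum.inr μ) f w = contract (dualTheta μ) (f w) := by
  simp only [dHol, derivRe, derivIm, Pi.smul_apply, Pi.sub_apply, oddDeriv_eq_contract, dualTheta,
    contract_smul, contract_sub]

theorem dBar_inr_eq (f : ChartFun n m) (w : Fin n → ℂ) (μ : Fin m) :
    dBar (Sum.inr μ) f w = contract (dualThetaBar μ) (f w) := by
  simp only [dBar, derivRe, derivIm, Pi.smul_apply, Pi.add_apply, oddDeriv_eq_contract,
    dualThetaBar, contract_smul, contract_add]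

theorem sum_single_re (w : Fin n → ℂ) (a : Fin n) (c : ℂ) :
    ∑ b, 2 * (star (w b) * (Pi.single a c : Fin n → ℂ) b).re = 2 * (star (w a) * c).re := by
  rw [Finset.sum_eq_single a]
  · simp
  · intro b _ h
    simp [h]
  · simp

theorem dBar_inl_evalTau {F : ℝ → ℝ} (w : Fin n → ℂ) (a : Fin n)
    (hF : ContDiffAt ℝ ∞ F (bodySq w)) :
    dBar (Sum.inl a) (fun u => (evalTau m F (bodySq u) : Grassmann m)) w
      = w a • (evalTau m (deriv F) (bodySq w) : Grassmann m) := by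
  rw [dBar_inl_eq (hasEvenDerivAt_evalTau _ w hF) (hasEvenDerivAt_evalTau _ w hF), sum_single_re,
    sum_single_re, smul_smul, ← add_smul, smul_smul]
  congr 1
  apply Complex.ext <;> simp

theorem dBar_inr_evalTau (F : ℝ → ℝ) (w : Fin n → ℂ) (μ : Fin m) :
    dBar (Sum.inr μ) (fun u => (evalTau m F (bodySq u) : Grassmann m)) w
      = (evalTau m (deriv F) (bodySq w) : Grassmann m) * (-(Complex.I • theta μ)) := by
  rw [dBar_inr_eq, contract_evalTau, contract_dualThetaBar_tau]

theorem dHol_inl_smul_evalTau {F : ℝ → ℝ} (w : Fin n → ℂ) (a b : Fin n)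
    (hF : ContDiffAt ℝ ∞ F (bodySq w)) :
    dHol (Sum.inl a) (fun u => u b • (evalTau m F (bodySq u) : Grassmann m)) w
      = (if a = b then 1 else 0 : ℂ) • (evalTau m F (bodySq w) : Grassmann m)
        + (star (w a) * w b) • (evalTau m (deriv F) (bodySq w) : Grassmann m) := by
  rw [dHol_inl_eq (hasEvenDerivAt_smul_evalTau _ w b hF) (hasEvenDerivAt_smul_evalTau _ w b hF),
    sum_single_re, sum_single_re]
  have h1 : ∀ c : ℂ, (Pi.single a c : Fin n → ℂ) b = (if a = b then 1 else 0) * c := by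
    intro c
    by_cases h : a = b
    · subst h; simp
    · simp [h]
  rw [h1, h1]
  set e : ℂ := if a = b then 1 else 0
  -- The derivatives of r along x^a and y^a, combined as in ∂_a, give back w̄^a.
  have h2 : star (w a) = (((star (w a) * 1).re : ℝ) : ℂ)
      - Complex.I * (((star (w a) * Complex.I).re : ℝ) : ℂ) := by
    apply Complex.ext <;> simp
  generalize (star (w a) * 1).re = p at h2 ⊢
  generalize (star (w a) * Complex.I).re = q at h2 ⊢
  rw [h2]
  push_cast
  match_scalars
  · linear_combination (-1 / 2 * e) * Complex.I_mul_I
  · ring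

theorem dHol_inl_evalTau_mul {F : ℝ → ℝ} (w : Fin n → ℂ) (a : Fin n) (g : Grassmann m)
    (hF : ContDiffAt ℝ ∞ F (bodySq w)) :
    dHol (Sum.inl a) (fun u => (evalTau m F (bodySq u) : Grassmann m) * g) w
      = star (w a) • ((evalTau m (deriv F) (bodySq w) : Grassmann m) * g) := by
  rw [dHol_inl_eq ((hasEvenDerivAt_evalTau _ w hF).mul_const g)
    ((hasEvenDerivAt_evalTau _ w hF).mul_const g), sum_single_re,
    sum_single_re, smul_mul_assoc, smul_mul_assoc, smul_smul, ← sub_smul, smul_smul]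
  congr 1
  apply Complex.ext <;> simp

/-! ### Components of the Fubini–Study form -/

/-- The even element `1 / N`. -/
def invN (m : ℕ) (r : ℝ) : EvenGrassmann m := evalTau m (fun x => x⁻¹) r

theorem evalTau_deriv_log (r : ℝ) : evalTau m (deriv Real.log) r = invN m r := by
  rw [Real.deriv_log']
  rfl

theorem evalTau_deriv_inv {r : ℝ} (hr : r ≠ 0) :
    evalTau m (deriv fun x : ℝ => x⁻¹) r = -invN m r ^ 2 := by
  have h : ContDiffAt ℝ ∞ (fun x : ℝ => x⁻¹) r := contDiffAt_inv ℝ hr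
  rw [pow_two, invN, evalTau_mul h h, deriv_inv', evalTau, evalTau, taylorAt_neg]
  congr 2
  funext x
  simp [pow_two]

theorem invN_mul {r : ℝ} (hr : r ≠ 0) :
    invN m r * (algebraMap ℂ (EvenGrassmann m) r + tau m) = 1 := by
  rw [← evalTau_id, invN, evalTau_mul (F := fun x => x⁻¹) (G := fun x => x)
    (contDiffAt_inv ℝ hr) contDiffAt_id]
  have h : ((fun x : ℝ => x⁻¹) * fun x => x) =ᶠ[nhds r] fun _ => 1 := by
    filter_upwards [isOpen_ne.mem_nhds hr] with x hx
    exact inv_mul_cancel₀ hx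
  rw [evalTau, taylorAt_congr h, taylorAt_const (by omega)]
  simp

theorem superEval_log_hermSq (k : Fin (n + 1)) :
    (fun u : Fin n → ℂ => superEval Real.log (hermSq (m := m) k u))
      = fun u => (evalTau m Real.log (bodySq u) : Grassmann m) := by
  funext u
  rw [hermSq_eq, superEval_algebraMap_add_tau]

variable (R : ℝ) (k : Fin (n + 1)) (w : Fin n → ℂ)

theorem dBar_inl_log (b : Fin n) :
    dBar (Sum.inl b) (fun u => superEval Real.log (hermSq (m := m) k u))
      = fun u => u b • (invN m (bodySq u) : Grassmann m) := by
  funext u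
  rw [superEval_log_hermSq,
    dBar_inl_evalTau _ _ (Real.contDiffAt_log.mpr (bodySq_pos u).ne'), evalTau_deriv_log]

theorem dBar_inr_log (ν : Fin m) :
    dBar (Sum.inr ν) (fun u => superEval Real.log (hermSq (m := m) k u))
      = fun u => (invN m (bodySq u) : Grassmann m) * (-(Complex.I • theta ν)) := by
  funext u
  rw [superEval_log_hermSq, dBar_inr_evalTau, evalTau_deriv_log]

theorem fubiniStudy_inl_inl (a b : Fin n) :
    fubiniStudy (m := m) R k w (Sum.inl a) (Sum.inl b)
      = ((((R : ℂ) ^ 2) • ((if a = b then 1 else 0 : ℂ) • invN m (bodySq w)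
        - (star (w a) * w b) • invN m (bodySq w) ^ 2) : EvenGrassmann m) : Grassmann m) := by
  have hr := (bodySq_pos w).ne'
  rw [fubiniStudy, dBar_inl_log]
  have := dHol_inl_smul_evalTau (m := m) w a b (contDiffAt_inv ℝ hr)
  rw [evalTau_deriv_inv hr] at this
  simp only [invN] at this ⊢
  rw [this]
  push_cast
  rw [smul_neg, sub_eq_add_neg]

theorem fubiniStudy_inl_inr (a : Fin n) (ν : Fin m) :
    fubiniStudy R k w (Sum.inl a) (Sum.inr ν)
      = (((R : ℂ) ^ 2 * Complex.I * star (w a)) •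
          (invN m (bodySq w) ^ 2 : EvenGrassmann m) : Grassmann m) * theta ν := by
  have hr := (bodySq_pos w).ne'
  rw [fubiniStudy, dBar_inr_log]
  have := dHol_inl_evalTau_mul (m := m) w a (-(Complex.I • theta ν)) (contDiffAt_inv ℝ hr)
  rw [evalTau_deriv_inv hr] at this
  simp only [invN] at this ⊢
  rw [this]
  push_cast
  rw [neg_mul_neg, mul_smul_comm, smul_smul, smul_smul, smul_mul_assoc]
  congr 1
  ring

theorem fubiniStudy_inr_inl (μ : Fin m) (b : Fin n) :
    fubiniStudy R k w (Sum.inr μ) (Sum.inl b)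
      = -((((R : ℂ) ^ 2 * Complex.I * w b) •
          (invN m (bodySq w) ^ 2 : EvenGrassmann m) : Grassmann m) * thetaBar μ) := by
  have hr := (bodySq_pos w).ne'
  rw [fubiniStudy, dBar_inl_log, dHol_inr_eq, map_smul, invN, contract_evalTau, contract_dualTheta_tau,
    evalTau_deriv_inv hr, invN]
  push_cast
  rw [neg_mul, mul_smul_comm, smul_neg, smul_neg, smul_smul, smul_smul, smul_mul_assoc]
  congr 2
  ring

/-- The indices of θ^ν θ̄^μ appear in transposed order because ∂_μ̄-type differentiation of N leaves
θ^ν while ∂_μ leaves θ̄^μ. -/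
theorem fubiniStudy_inr_inr (μ ν : Fin m) :
    fubiniStudy R k w (Sum.inr μ) (Sum.inr ν)
      = ((((R : ℂ) ^ 2) • ((if μ = ν then -Complex.I else 0 : ℂ) • invN m (bodySq w)
        + invN m (bodySq w) ^ 2 * thetaThetaBar ν μ) : EvenGrassmann m) : Grassmann m) := by
  have hr := (bodySq_pos w).ne'
  rw [fubiniStudy, dBar_inr_log, dHol_inr_eq, even_commute (invN m (bodySq w)).2, neg_mul, smul_mul_assoc,
    map_neg, map_smul, theta_eq_ι, contract_ι_mul, dualTheta_thetaVec, invN, contract_evalTau,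
    contract_dualTheta_tau, evalTau_deriv_inv hr, ← theta_eq_ι, invN]
  push_cast
  congr 1
  rw [← mul_assoc, ← even_commute (neg_mem (pow_mem (evalTau m (fun x : ℝ => x⁻¹) (bodySq w)).2 2)),
    mul_smul_comm, mul_assoc, thetaThetaBar, smul_sub, smul_smul, smul_smul, neg_sub, neg_mul,
    Complex.I_mul_I]
  by_cases h : μ = ν
  · simp [h]
    abel
  · simp [h]

end HermitianSquare

section MatrixIdentities

/-! ### Matrices of the form `u_i v_j` with odd `u_i`, `v_j` -/

section OddRankOne

variable {A : Type*} [CommRing A] [Algebra ℂ A]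

theorem eq_zero_of_eq_neg {x : A} (h : x = -x) : x = 0 := by
  have h2 : (2 : ℂ) • x = 0 := by
    rw [two_smul]
    nth_rewrite 1 [h]
    exact neg_add_cancel x
  exact (smul_eq_zero_iff_right (two_ne_zero : (2 : ℂ) ≠ 0)).mp h2

/-- The hypothesis models e_ij = u_i v_j with odd u, v. For even vectors det(1 - α e) = 1 - α tr e;
oddness inverts this to 1/(1 + α tr e). The induction takes the Schur complement of the last
diagonal entry, which is again of the form 1 - α' e' for a smaller matrix e' of the same kind. -/
theorem det_one_sub_smul_mul_of_anticomm {k : ℕ} (e : Matrix (Fin k) (Fin k) A) (α : A)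
    (he : ∀ i j i' j', e i j * e i' j' = -(e i j' * e i' j)) :
    (1 - α • e).det * (1 + α * e.trace) = 1 := by
  induction k generalizing α with
  | zero => simp [Matrix.trace]
  | succ k ih =>
    set f : Fin k ⊕ Fin 1 ≃ Fin (k + 1) := finSumFinEquiv with hf
    set q := e (Fin.last k) (Fin.last k) with hq
    have hfl : ∀ i : Fin 1, f (Sum.inr i) = Fin.last k := by
      intro i
      fin_cases i
      rfl
    have hfr : ∀ i : Fin k, f (Sum.inl i) = i.castSucc := fun i => rfl
    have hq2 : q * q = 0 := eq_zero_of_eq_neg (he _ _ _ _)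
    set N := (1 - α • e).submatrix f f with hN
    have hN1 : N.toBlocks₁₂ = Matrix.of fun i _ => -(α * e i.castSucc (Fin.last k)) := by
      ext i j
      simp only [hN, Matrix.toBlocks₁₂, Matrix.of_apply, Matrix.submatrix_apply, Matrix.sub_apply,
        Matrix.smul_apply, smul_eq_mul, hfl, hfr]
      rw [Matrix.one_apply_ne (Fin.castSucc_lt_last i).ne, zero_sub]
    have hN2 : N.toBlocks₂₁ = Matrix.of fun _ j => -(α * e (Fin.last k) j.castSucc) := by
      ext i j
      simp only [hN, Matrix.toBlocks₂₁, Matrix.of_apply, Matrix.submatrix_apply, Matrix.sub_apply,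
        Matrix.smul_apply, smul_eq_mul, hfl, hfr]
      rw [Matrix.one_apply_ne (Fin.castSucc_lt_last j).ne', zero_sub]
    have hN3 : N.toBlocks₂₂ = Matrix.of fun _ _ => 1 - α * q := by
      ext i j
      simp only [hN, Matrix.toBlocks₂₂, Matrix.of_apply, Matrix.submatrix_apply, Matrix.sub_apply,
        Matrix.smul_apply, smul_eq_mul, hfl, Matrix.one_apply_eq, hq]
    have hN4 : N.toBlocks₁₁
        = 1 - α • Matrix.of fun i j : Fin k => e i.castSucc j.castSucc := by
      ext i j
      simp only [hN, Matrix.toBlocks₁₁, Matrix.of_apply, Matrix.submatrix_apply, Matrix.sub_apply,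
        Matrix.smul_apply, smul_eq_mul, hfr, Matrix.one_apply, Fin.castSucc_inj]
    -- The inverse of 1 - αq is 1 + αq because q² = 0.
    let _ : Invertible N.toBlocks₂₂ :=
      { invOf := Matrix.of fun _ _ => 1 + α * q
        invOf_mul_self := by
          ext i j
          obtain rfl : i = j := Subsingleton.elim i j
          rw [hN3]
          simp only [Matrix.mul_apply, Matrix.of_apply, Fin.sum_univ_one, Matrix.one_apply_eq]
          linear_combination -α ^ 2 * hq2
        mul_invOf_self := by
          ext i j
          obtain rfl : i = j := Subsingleton.elim i j
          rw [hN3]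
          simp only [Matrix.mul_apply, Matrix.of_apply, Fin.sum_univ_one, Matrix.one_apply_eq]
          linear_combination -α ^ 2 * hq2 }
    have hinv : ⅟N.toBlocks₂₂ = Matrix.of fun _ _ => 1 + α * q := rfl
    -- With l the last index, e_il e_lj = -e_ij q, so the correction is again proportional to e_ij;
    -- its cubic part dies by e_il q = 0. This gives α' = α(1 - αq).
    have hS : N.toBlocks₁₁ - N.toBlocks₁₂ * ⅟N.toBlocks₂₂ * N.toBlocks₂₁
        = 1 - (α * (1 - α * q)) • Matrix.of fun i j : Fin k => e i.castSucc j.castSucc := by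
      rw [hinv, hN1, hN2, hN4]
      ext i j
      simp only [Matrix.mul_apply, Matrix.of_apply, Fin.sum_univ_one, Matrix.sub_apply,
        Matrix.smul_apply, smul_eq_mul]
      have h1 := he i.castSucc (Fin.last k) (Fin.last k) j.castSucc
      have h2 : e i.castSucc (Fin.last k) * q = 0 := eq_zero_of_eq_neg (he _ _ _ _)
      linear_combination (-α ^ 2) * h1 - α ^ 3 * e (Fin.last k) j.castSucc * h2
    have hdet : (1 - α • e).det = (1 - α * q)
        * (1 - (α * (1 - α * q)) • Matrix.of fun i j : Fin k => e i.castSucc j.castSucc).det := by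
      rw [← Matrix.det_submatrix_equiv_self f, ← hN, ← Matrix.fromBlocks_toBlocks N,
        Matrix.det_fromBlocks₂₂, hS, hN3, Matrix.det_fin_one, Matrix.of_apply]
    have htr : e.trace = (Matrix.of fun i j : Fin k => e i.castSucc j.castSucc).trace + q := by
      simp [Matrix.trace, Fin.sum_univ_castSucc, hq]
    have := ih (Matrix.of fun i j : Fin k => e i.castSucc j.castSucc) (α * (1 - α * q))
      (fun i j i' j' => he _ _ _ _)
    refine Eq.trans ?_ this
    rw [hdet, htr]
    linear_combination (-α ^ 2) *
      (1 - (α * (1 - α * q)) • Matrix.of fun i j : Fin k => e i.castSucc j.castSucc).det * hq2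

end OddRankOne

/-- The rank-one relation e² = (tr e) e with the sign caused by odd factors. -/
theorem mul_self_of_anticomm {A : Type*} [CommRing A] {k : ℕ}
    (e : Matrix (Fin k) (Fin k) A) (he : ∀ i j i' j', e i j * e i' j' = -(e i j' * e i' j)) :
    e * e = -(e.trace • e) := by
  ext i j
  simp only [Matrix.mul_apply, Matrix.neg_apply, Matrix.smul_apply, smul_eq_mul, Matrix.trace,
    Matrix.diag_apply, Finset.sum_mul, ← Finset.sum_neg_distrib]
  refine Finset.sum_congr rfl fun l _ => ?_
  rw [he, mul_comm]

/-! ### Hermitian forms in real coordinates -/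

section RealForm

variable {A : Type*} [Ring A] [Algebra ℂ A] {p q s : Type*}

/-- The matrix `c_A c̄_B h_{ab} + c̄_A c_B h'_{ab}`, `A` and `B` running over the real and the
imaginary parts of complex coordinates `a` and `b`. -/
def realForm (h h' : Matrix p q A) : Matrix (p ⊕ p) (q ⊕ q) A :=
  Matrix.fromBlocks (h + h') (Complex.I • (h' - h)) (Complex.I • (h - h')) (h + h')

/-- `realForm h h'` is P ⊗ h + P̄ ⊗ h' for the 2 × 2 matrix P with rows (1, -i), (i, 1). Since P² =
2P and P P̄ = P̄ P = 0, the two halves multiply separately and the factor 2 appears. -/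
theorem realForm_mul [Fintype q] (h h' : Matrix p q A) (k k' : Matrix q s A) :
    realForm h h' * realForm k k' = (2 : ℂ) • realForm (h * k) (h' * k') := by
  rw [realForm, realForm, realForm, Matrix.fromBlocks_multiply, Matrix.fromBlocks_smul]
  have hI := Complex.I_mul_I
  congr 1 <;>
  · simp only [Matrix.mul_add, Matrix.add_mul, Matrix.sub_mul, Matrix.mul_sub,
      Matrix.smul_mul, Matrix.mul_smul, smul_sub, smul_add, smul_smul, hI]
    module

theorem realForm_sub (h h' k k' : Matrix p q A) :
    realForm h h' - realForm k k' = realForm (h - k) (h' - k') := by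
  rw [realForm, realForm, realForm, sub_eq_add_neg, Matrix.fromBlocks_neg, Matrix.fromBlocks_add]
  congr 1 <;> module

theorem realForm_smul (c : ℂ) (h h' : Matrix p q A) :
    c • realForm h h' = realForm (c • h) (c • h') := by
  rw [realForm, realForm, Matrix.fromBlocks_smul]
  congr 1 <;> module

theorem realForm_half [DecidableEq p] :
    realForm ((1 / 2 : ℂ) • (1 : Matrix p p A)) ((1 / 2 : ℂ) • 1) = 1 := by
  rw [realForm, sub_self, smul_zero, ← add_smul, ← Matrix.fromBlocks_one]
  norm_num

theorem realForm_map {B : Type*} [Ring B] [Algebra ℂ B] (φ : A →ₐ[ℂ] B) (h h' : Matrix p q A) :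
    (realForm h h').map φ = realForm (h.map φ) (h'.map φ) := by
  rw [realForm, realForm, Matrix.fromBlocks_map]
  congr 1 <;> ext i j <;> simp

theorem det_realForm {A : Type*} [CommRing A] [Algebra ℂ A] [Fintype p] [DecidableEq p]
    (h h' : Matrix p p A) :
    (realForm h h').det = ((2 : ℂ) • h).det * ((2 : ℂ) • h').det := by
  have hI := Complex.I_mul_I
  -- Conjugation by this unipotent matrix, a passage to complex coordinates, triangularizes the form
  -- with diagonal blocks 2h' and 2h.
  have key : Matrix.fromBlocks 1 (Complex.I • 1) 0 1 * realForm h h'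
      * Matrix.fromBlocks 1 (-(Complex.I • 1)) 0 1
      = Matrix.fromBlocks ((2 : ℂ) • h') 0 (Complex.I • (h - h')) ((2 : ℂ) • h) := by
    rw [realForm, Matrix.fromBlocks_multiply, Matrix.fromBlocks_multiply]
    congr 1 <;>
    · try simp only [Matrix.one_mul, Matrix.mul_one, Matrix.mul_zero, Matrix.zero_mul, zero_add,
        add_zero, Matrix.mul_add, Matrix.mul_sub,
      Matrix.smul_mul, Matrix.mul_smul, smul_smul,
        Matrix.mul_neg, smul_sub, hI]
      try module
  have h1 := congrArg Matrix.det key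
  rw [Matrix.det_mul, Matrix.det_mul, Matrix.det_fromBlocks_zero₂₁, Matrix.det_fromBlocks_zero₂₁,
    Matrix.det_fromBlocks_zero₁₂] at h1
  simpa [mul_comm] using h1

end RealForm

end MatrixIdentities

section Berezinian

variable {n m : ℕ}

/-! ### The Berezinian of the real form of a Hermitian matrix -/

theorem evenPart_coe (x : EvenGrassmann m) : evenPart (x : Grassmann m) = x := by
  apply Subtype.ext
  exact DirectSum.decompose_of_mem_same _ x.2

theorem map_evenPart_map_val {p q : Type*} (M : Matrix p q (EvenGrassmann m)) :
    (M.map (EvenGrassmann m).val).map evenPart = M :=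
  Matrix.ext fun _ _ => evenPart_coe _

theorem inverse_eq_of_mul_eq_one {A : Type*} [MonoidWithZero A] {a b : A} (h : a * b = 1)
    (h' : b * a = 1) : Ring.inverse a = b :=
  Ring.inverse_unit ⟨a, b, h, h'⟩

/-- The matrix `α c_A c̄_B h_{a b̄} + β (-1)^{ãb̃} c̄_A c_B h_{b ā}`. -/
def tensorMatrix (α β : ℂ) (h : Matrix (Fin n ⊕ Fin m) (Fin n ⊕ Fin m) (Grassmann m)) :
    Matrix (RealIdx n m) (RealIdx n m) (Grassmann m) := fun A B =>
  (α * (unit A * star (unit B))) • h (cplx A) (cplx B)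
    + (β * (koszul A B * star (unit A) * unit B)) • h (cplx B) (cplx A)

theorem reMatrix_eq_tensorMatrix
    (h : Matrix (Fin n ⊕ Fin m) (Fin n ⊕ Fin m) (Grassmann m)) :
    reMatrix h = tensorMatrix (1 / 2) (1 / 2) h := by
  ext A B
  rw [reMatrix, tensorMatrix, smul_add, smul_smul, smul_smul]

theorem negImMatrix_eq_tensorMatrix
    (h : Matrix (Fin n ⊕ Fin m) (Fin n ⊕ Fin m) (Grassmann m)) :
    negImMatrix h = tensorMatrix (Complex.I / 2) (-(Complex.I / 2)) h := by
  ext A B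
  rw [negImMatrix, tensorMatrix, smul_sub, smul_smul, smul_smul, neg_mul, neg_smul, sub_eq_add_neg]

section Blocks

variable (α β : ℂ) (h : Matrix (Fin n ⊕ Fin m) (Fin n ⊕ Fin m) (Grassmann m))

theorem tensorMatrix_toBlocks₁₁ : (tensorMatrix α β h).toBlocks₁₁
    = realForm (α • h.toBlocks₁₁) (β • h.toBlocks₁₁.transpose) := by
  ext (a | a) (b | b) <;>
  · simp [tensorMatrix, realForm, Matrix.toBlocks₁₁, unit, cplx, koszul]
    try module

theorem tensorMatrix_toBlocks₁₂ : (tensorMatrix α β h).toBlocks₁₂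
    = realForm (α • h.toBlocks₁₂) (β • h.toBlocks₂₁.transpose) := by
  ext (a | a) (b | b) <;>
  · simp [tensorMatrix, realForm, Matrix.toBlocks₁₂, Matrix.toBlocks₂₁, unit, cplx, koszul]
    try module

theorem tensorMatrix_toBlocks₂₁ : (tensorMatrix α β h).toBlocks₂₁
    = realForm (α • h.toBlocks₂₁) (β • h.toBlocks₁₂.transpose) := by
  ext (a | a) (b | b) <;>
  · simp [tensorMatrix, realForm, Matrix.toBlocks₁₂, Matrix.toBlocks₂₁, unit, cplx, koszul]
    try module

/-- Only the odd-odd block feels the Koszul sign; this minus is the source of (-1)^m in the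
Berezinian. -/
theorem tensorMatrix_toBlocks₂₂ : (tensorMatrix α β h).toBlocks₂₂
    = realForm (α • h.toBlocks₂₂) (-(β • h.toBlocks₂₂.transpose)) := by
  ext (a | a) (b | b) <;>
  · simp [tensorMatrix, realForm, Matrix.toBlocks₂₂, unit, cplx, koszul]
    try module

end Blocks

/-- All four blocks are real forms, so inverse, Schur complement and determinants are computed in
each half separately. The second half is the transpose of the first up to scalars and signs, and the
scalars enter the result only through αβ. Hence the metric (½, ½) and the symplectic form (i/2,
-i/2) give the same answer. -/
theorem ber_tensorMatrix {α β : ℂ} (hαβ : 4 * (α * β) = 1)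
    (h : Matrix (Fin n ⊕ Fin m) (Fin n ⊕ Fin m) (Grassmann m))
    (H K : Matrix (Fin m) (Fin m) (EvenGrassmann m)) (S : Matrix (Fin n) (Fin n) (EvenGrassmann m))
    (hH : h.toBlocks₂₂ = H.map (EvenGrassmann m).val) (hHK : H * K = 1)
    (hS : h.toBlocks₁₁ - h.toBlocks₁₂ * K.map (EvenGrassmann m).val * h.toBlocks₂₁
      = S.map (EvenGrassmann m).val)
    (hodd : ∀ a μ ν b, h.toBlocks₁₂ a μ * h.toBlocks₂₁ ν b
      = -(h.toBlocks₂₁ ν b * h.toBlocks₁₂ a μ)) :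
    ber (tensorMatrix α β h) = S.det ^ 2 * Ring.inverse ((-1) ^ m * H.det ^ 2) := by
  have hKH : K * H = 1 := mul_eq_one_comm.mp hHK
  have hquarter : α * β = 1 / 4 := by linear_combination hαβ / 4
  have hJ : (tensorMatrix α β h).toBlocks₂₂
      = (realForm (α • H) (-(β • H.transpose))).map (EvenGrassmann m).val := by
    rw [tensorMatrix_toBlocks₂₂, hH, realForm_map]
    congr 1
  -- Stated for all scalars and matrices because it is used twice, with the roles of H and K
  -- exchanged, to get a two-sided inverse over the noncommutative Grassmann algebra.
  have hinvE : ∀ (α β : ℂ) (H K : Matrix (Fin m) (Fin m) (EvenGrassmann m)), α * β = 1 / 4 →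
      H * K = 1 → K * H = 1 →
      realForm (α • H) (-(β • H.transpose)) * realForm (β • K) (-(α • K.transpose)) = 1 := by
    intro α β H K hab h1 h2
    rw [realForm_mul, ← realForm_half, realForm_smul, neg_mul_neg, Matrix.smul_mul, Matrix.mul_smul,
      Matrix.smul_mul, Matrix.mul_smul, h1, ← Matrix.transpose_mul, h2, Matrix.transpose_one,
      smul_smul, smul_smul, smul_smul, smul_smul, show 2 * α * β = 1 / 2 by linear_combination 2 * hab,
      show 2 * β * α = 1 / 2 by linear_combination 2 * hab]
  have hinv : Ring.inverse (tensorMatrix α β h).toBlocks₂₂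
      = (realForm (β • K) (-(α • K.transpose))).map (EvenGrassmann m).val := by
    rw [hJ]
    apply inverse_eq_of_mul_eq_one
    · rw [← Matrix.map_mul, hinvE α β H K hquarter hHK hKH]
      exact Matrix.map_one _ (map_zero _) (map_one _)
    · rw [← Matrix.map_mul, hinvE β α K H (by rw [mul_comm, hquarter]) hKH hHK]
      exact Matrix.map_one _ (map_zero _) (map_one _)
  -- Transposing a product with two odd factors costs a sign, which cancels the minus in the
  -- conjugate half of the inverse.
  have htr : h.toBlocks₂₁.transpose * (K.map (EvenGrassmann m).val).transpose
        * h.toBlocks₁₂.transpose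
      = -(h.toBlocks₁₂ * K.map (EvenGrassmann m).val * h.toBlocks₂₁).transpose := by
    ext a b
    simp only [Matrix.mul_apply, Matrix.transpose_apply, Matrix.neg_apply, Finset.sum_mul,
      ← Finset.sum_neg_distrib, Matrix.map_apply]
    rw [Finset.sum_comm]
    refine Finset.sum_congr rfl fun μ _ => Finset.sum_congr rfl fun ν _ => ?_
    change _ * (K ν μ : Grassmann m) * _ = -(_ * (K ν μ : Grassmann m) * _)
    rw [← even_commute (K ν μ).2, ← even_commute (K ν μ).2, mul_assoc, mul_assoc, hodd, mul_neg,
      neg_neg]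
  have hschur : (tensorMatrix α β h).toBlocks₁₁ - (tensorMatrix α β h).toBlocks₁₂
        * Ring.inverse (tensorMatrix α β h).toBlocks₂₂ * (tensorMatrix α β h).toBlocks₂₁
      = (realForm (α • S) (β • S.transpose)).map (EvenGrassmann m).val := by
    rw [hinv, realForm_map, tensorMatrix_toBlocks₁₁, tensorMatrix_toBlocks₁₂,
      tensorMatrix_toBlocks₂₁, realForm_map, realForm_mul, Matrix.smul_mul, realForm_mul,
      realForm_smul, realForm_smul, realForm_sub]
    have h1 : (β • K).map (EvenGrassmann m).val = β • K.map (EvenGrassmann m).val := by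
      ext i j; simp
    have h2 : (-(α • K.transpose)).map (EvenGrassmann m).val
        = -(α • (K.map (EvenGrassmann m).val).transpose) := by
      ext i j; simp
    have h3 : (α • S).map (EvenGrassmann m).val = α • S.map (EvenGrassmann m).val := by
      ext i j; simp
    have h4 : (β • S.transpose).map (EvenGrassmann m).val
        = β • (S.map (EvenGrassmann m).val).transpose := by
      ext i j; simp
    rw [h1, h2, h3, h4, ← hS, Matrix.transpose_sub, ← neg_eq_iff_eq_neg.mpr htr]
    simp only [Matrix.smul_mul, Matrix.mul_smul, Matrix.mul_neg, Matrix.neg_mul, smul_smul]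
    congr 1
    · rw [smul_sub]
      congr 2
      linear_combination α * hαβ
    · rw [smul_sub, smul_neg, smul_neg, smul_smul,
        show 2 * (2 * β) * (α * β) = β by linear_combination β * hαβ]
  rw [ber, hschur, hJ, map_evenPart_map_val, map_evenPart_map_val, det_realForm, det_realForm,
    smul_smul, smul_smul, smul_neg, smul_smul, smul_smul, ← neg_smul, Matrix.det_smul_of_tower, Matrix.det_smul_of_tower,
    Matrix.det_smul_of_tower, Matrix.det_smul_of_tower, Matrix.det_transpose, Matrix.det_transpose, Fintype.card_fin,
    Fintype.card_fin]
  have e1 : (2 * α) ^ n • S.det * (2 * β) ^ n • S.det = S.det ^ 2 := by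
    rw [smul_mul_smul_comm, ← mul_pow, show 2 * α * (2 * β) = 4 * (α * β) by ring, hαβ, one_pow,
      one_smul, pow_two]
  have e2 : (2 * α) ^ m • H.det * (-(2 * β)) ^ m • H.det = (-1) ^ m * H.det ^ 2 := by
    rw [smul_mul_smul_comm, ← mul_pow, show 2 * α * -(2 * β) = -(4 * (α * β)) by ring, hαβ,
      Algebra.smul_def, map_pow, map_neg, map_one, pow_two]
  rw [e1, e2]

end Berezinian

section VolumeElement

variable {n m : ℕ}

/-! ### The volume elements -/

theorem contDiffAt_zpow {r : ℝ} (hr : r ≠ 0) (q : ℤ) : ContDiffAt ℝ ∞ (fun x : ℝ => x ^ q) r := by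
  obtain ⟨j, rfl | rfl⟩ := q.eq_nat_or_neg
  · simp only [zpow_natCast]
    exact (contDiff_id.pow j).contDiffAt
  · simp only [zpow_neg, zpow_natCast]
    exact (contDiff_id.pow j).contDiffAt.inv (pow_ne_zero j hr)

theorem evalTau_zpow_add {r : ℝ} (hr : r ≠ 0) (p q : ℤ) :
    evalTau m (fun x => x ^ (p + q)) r
      = evalTau m (fun x => x ^ p) r * evalTau m (fun x => x ^ q) r := by
  rw [evalTau_mul (contDiffAt_zpow hr p) (contDiffAt_zpow hr q)]
  refine taylorAt_congr ?_
  filter_upwards [isOpen_ne.mem_nhds hr] with x hx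
  exact zpow_add₀ hx p q

theorem invN_pow {r : ℝ} (hr : r ≠ 0) (j : ℕ) :
    invN m r ^ j = evalTau m (fun x => x ^ (-(j : ℤ))) r := by
  induction j with
  | zero =>
    simp only [pow_zero, Nat.cast_zero, neg_zero, zpow_zero]
    rw [evalTau, taylorAt_const (by omega)]
    simp
  | succ j ih =>
    rw [pow_succ, ih, show (-((j + 1 : ℕ) : ℤ)) = -(j : ℤ) + (-1) by push_cast; ring,
      evalTau_zpow_add hr]
    simp only [invN, zpow_neg_one]

/-- The matrix `θ̄^μ θ^ν`, up to sign. -/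
def oddMatrix (m : ℕ) : Matrix (Fin m) (Fin m) (EvenGrassmann m) :=
  Matrix.of fun μ ν => thetaThetaBar ν μ

theorem oddMatrix_anticomm (i j i' j' : Fin m) :
    oddMatrix m i j * oddMatrix m i' j' = -(oddMatrix m i j' * oddMatrix m i' j) := by
  apply Subtype.ext
  change theta j * thetaBar i * (theta j' * thetaBar i')
    = -(theta j' * thetaBar i * (theta j * thetaBar i'))
  have key : theta j * thetaBar i * theta j' = -(theta j' * thetaBar i * theta j) := by
    rw [mul_assoc, ← neg_eq_iff_eq_neg.mpr (theta_mul_thetaBar j' i), mul_neg, ← mul_assoc,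
      theta_mul_theta j j', neg_mul, neg_neg, mul_assoc, theta_mul_thetaBar j i, mul_neg,
      ← mul_assoc]
  rw [← mul_assoc, key, neg_mul, mul_assoc]

theorem trace_oddMatrix : (oddMatrix m).trace = -(Complex.I • tau m) := by
  rw [tau, smul_smul, Complex.I_mul_I, neg_smul, one_smul, neg_neg]
  rfl

/-- Multiples of 1 - a e are closed under multiplication because e² = -(tr e) e. -/
theorem smul_one_sub_mul_smul_one_sub {A : Type*} [CommRing A] {k : ℕ}
    {e : Matrix (Fin k) (Fin k) A} (he : ∀ i j i' j', e i j * e i' j' = -(e i j' * e i' j))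
    (a b c d : A) :
    (c • (1 - a • e)) * (d • (1 - b • e))
      = (c * d) • (1 - (a + b + a * b * e.trace) • e) := by
  rw [Matrix.smul_mul, Matrix.mul_smul, smul_smul, Matrix.sub_mul, Matrix.one_mul, Matrix.mul_sub,
    Matrix.mul_one, Matrix.smul_mul, Matrix.mul_smul, mul_self_of_anticomm e he]
  congr 1
  module

variable (R : ℝ) (k : Fin (n + 1)) (w : Fin n → ℂ)

/-- The odd block of the Fubini–Study form. -/
def oddBlock (m : ℕ) (R r : ℝ) : Matrix (Fin m) (Fin m) (EvenGrassmann m) :=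
  (algebraMap ℂ (EvenGrassmann m) (-(Complex.I * (R : ℂ) ^ 2)) * invN m r) •
    (1 - (algebraMap ℂ (EvenGrassmann m) (-Complex.I) * invN m r) • oddMatrix m)

/-- The inverse of the odd block of the Fubini–Study form. -/
def oddBlockInv (m : ℕ) (R r : ℝ) : Matrix (Fin m) (Fin m) (EvenGrassmann m) :=
  (algebraMap ℂ (EvenGrassmann m) (Complex.I * ((R : ℂ) ^ 2)⁻¹) * (algebraMap ℂ (EvenGrassmann m) (r : ℂ) + tau m)) •
    (1 - (algebraMap ℂ (EvenGrassmann m) (Complex.I * (r : ℂ)⁻¹)) • oddMatrix m)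

/-- The Schur complement of the odd block of the Fubini–Study form. -/
def evenSchur (m : ℕ) (R : ℝ) (w : Fin n → ℂ) : Matrix (Fin n) (Fin n) (EvenGrassmann m) :=
  (algebraMap ℂ (EvenGrassmann m) ((R : ℂ) ^ 2) * invN m (bodySq w)) •
    (1 - Matrix.of fun a b => star (w a) * (w b * (bodySq w : ℂ)⁻¹)).map
      (algebraMap ℂ (EvenGrassmann m))

variable {R}

/-- The coefficient b = i/r of the inverse solves a + b + ab tr e = 0 for a = -i/N and tr e = -iτ,
since 1 + a tr e = 1 - τ/N = r/N. -/
theorem oddBlock_mul_oddBlockInv {r : ℝ} (hR : R ≠ 0) (hr : r ≠ 0) :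
    oddBlock m R r * oddBlockInv m R r = 1 := by
  have hR' : (R : ℂ) ≠ 0 := by exact_mod_cast hR
  have hr' : (r : ℂ) ≠ 0 := by exact_mod_cast hr
  rw [oddBlock, oddBlockInv, smul_one_sub_mul_smul_one_sub oddMatrix_anticomm, trace_oddMatrix]
  have h1 : algebraMap ℂ (EvenGrassmann m) (-(Complex.I * (R : ℂ) ^ 2))
      * algebraMap ℂ (EvenGrassmann m) (Complex.I * ((R : ℂ) ^ 2)⁻¹) = 1 := by
    rw [← map_mul, ← map_one (algebraMap ℂ (EvenGrassmann m))]
    congr 1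
    field_simp
    simp
  have hv := invN_mul (m := m) hr
  have h2 : algebraMap ℂ (EvenGrassmann m) Complex.I * algebraMap ℂ (EvenGrassmann m) Complex.I = -1 := by
    rw [← map_mul, Complex.I_mul_I, map_neg, map_one]
  have h3 : algebraMap ℂ (EvenGrassmann m) (r : ℂ) * algebraMap ℂ (EvenGrassmann m) (r : ℂ)⁻¹ = 1 := by
    rw [← map_mul, mul_inv_cancel₀ hr', map_one]
  rw [show ∀ a v b N : EvenGrassmann m, a * v * (b * N) = (a * b) * (v * N) by intros; ring, h1, hv,
    Algebra.smul_def Complex.I (tau m)]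
  simp only [map_mul, map_neg]
  set i := algebraMap ℂ (EvenGrassmann m) Complex.I
  set ρ := algebraMap ℂ (EvenGrassmann m) (r : ℂ)
  set ρ' := algebraMap ℂ (EvenGrassmann m) (r : ℂ)⁻¹
  have h4 : -i * invN m r + i * ρ' + -i * invN m r * (i * ρ') * -(i * tau m) = 0 := by
    linear_combination (-i * ρ') * hv + (invN m r * i) * h3 + (i * ρ' * invN m r * tau m) * h2
  rw [h4, zero_smul, sub_zero, mul_one, one_smul]

/-- The factor 1 + α tr e of the odd determinant formula is here r/N; it multiplies the left side
because it sits in the denominator of the determinant. -/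
theorem det_oddBlock {r : ℝ} (hr : r ≠ 0) :
    (oddBlock m R r).det * (invN m r * algebraMap ℂ (EvenGrassmann m) (r : ℂ))
      = (algebraMap ℂ (EvenGrassmann m) (-(Complex.I * (R : ℂ) ^ 2)) * invN m r) ^ m := by
  have h := det_one_sub_smul_mul_of_anticomm (oddMatrix m)
    (algebraMap ℂ (EvenGrassmann m) (-Complex.I) * invN m r) oddMatrix_anticomm
  have h2 : algebraMap ℂ (EvenGrassmann m) Complex.I * algebraMap ℂ (EvenGrassmann m) Complex.I = -1 := by
    rw [← map_mul, Complex.I_mul_I, map_neg, map_one]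
  have h3 : 1 + algebraMap ℂ (EvenGrassmann m) (-Complex.I) * invN m r * (oddMatrix m).trace
      = invN m r * algebraMap ℂ (EvenGrassmann m) (r : ℂ) := by
    rw [trace_oddMatrix, Algebra.smul_def, map_neg]
    linear_combination (invN m r * tau m) * h2 - invN_mul (m := m) hr
  rw [h3] at h
  rw [oddBlock, Matrix.det_smul, Fintype.card_fin, mul_assoc, h, mul_one]

/-- The ordinary matrix determinant lemma: 1 - |w|²/r = 1/r. -/
theorem det_evenSchur :
    (evenSchur m R w).det * algebraMap ℂ (EvenGrassmann m) (bodySq w : ℂ)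
      = (algebraMap ℂ (EvenGrassmann m) ((R : ℂ) ^ 2) * invN m (bodySq w)) ^ n := by
  have hr : (bodySq w : ℂ) ≠ 0 := by exact_mod_cast (bodySq_pos w).ne'
  have hD : (1 - Matrix.of fun a b => star (w a) * (w b * (bodySq w : ℂ)⁻¹)).det
      = (bodySq w : ℂ)⁻¹ := by
    have h1 : (Matrix.of fun a b => star (w a) * (w b * (bodySq w : ℂ)⁻¹))
        = Matrix.replicateCol (Fin 1) (fun a => star (w a))
          * Matrix.replicateRow (Fin 1) (fun b => w b * (bodySq w : ℂ)⁻¹) := by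
      ext a b
      simp [Matrix.mul_apply]
    rw [h1, Matrix.det_one_sub_mul_comm, Matrix.det_fin_one]
    simp only [Matrix.sub_apply, Matrix.one_apply_eq, Matrix.mul_apply, Matrix.replicateRow_apply,
      Matrix.replicateCol_apply]
    have h2 : (bodySq w : ℂ) = 1 + ∑ a, w a * star (w a) := by
      rw [bodySq]
      push_cast
      congr 1
      exact Finset.sum_congr rfl fun a _ => (Complex.mul_conj (w a)).symm
    have h3 : ∑ a, w a * (bodySq w : ℂ)⁻¹ * star (w a)
        = (bodySq w : ℂ)⁻¹ * ∑ a, w a * star (w a) := by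
      rw [Finset.mul_sum]
      exact Finset.sum_congr rfl fun a _ => by ring
    rw [h3, show ∑ a, w a * star (w a) = (bodySq w : ℂ) - 1 by rw [h2]; ring]
    field_simp
    ring
  rw [evenSchur, Matrix.det_smul, Fintype.card_fin, ← RingHom.mapMatrix_apply, ← RingHom.map_det,
    hD, mul_assoc, ← map_mul, inv_mul_cancel₀ hr, map_one, mul_one]

theorem fubiniStudy_toBlocks₂₂ :
    (fubiniStudy (m := m) R k w).toBlocks₂₂
      = (oddBlock m R (bodySq w)).map (EvenGrassmann m).val := by
  ext μ ν
  simp only [Matrix.toBlocks₂₂, Matrix.of_apply, Matrix.map_apply]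
  rw [fubiniStudy_inr_inr]
  change _ = ((oddBlock m R (bodySq w) μ ν : EvenGrassmann m) : Grassmann m)
  congr 1
  simp only [oddBlock, Matrix.smul_apply, Matrix.sub_apply, smul_eq_mul, Matrix.one_apply, oddMatrix,
    Matrix.of_apply]
  simp only [Algebra.smul_def, map_neg, map_mul]
  have h2 : algebraMap ℂ (EvenGrassmann m) Complex.I * algebraMap ℂ _ Complex.I = -1 := by
    rw [← map_mul, Complex.I_mul_I, map_neg, map_one]
  have h3 : algebraMap ℂ (EvenGrassmann m) (if μ = ν then -Complex.I else 0)
      = -algebraMap ℂ (EvenGrassmann m) Complex.I * (if μ = ν then 1 else 0) := by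
    split_ifs <;> simp
  rw [h3]
  linear_combination (algebraMap ℂ (EvenGrassmann m) ((R : ℂ) ^ 2) * invN m (bodySq w) ^ 2
    * thetaThetaBar ν μ) * h2

theorem even_mul_even_mul (X Y : EvenGrassmann m) (x y : Grassmann m) :
    (X : Grassmann m) * x * ((Y : Grassmann m) * y) = X * Y * (x * y) := by
  rw [mul_assoc, ← mul_assoc x, ← even_commute Y.2]
  simp only [mul_assoc]

theorem toBlocks₁₂_mul_mul_toBlocks₂₁ (K : Matrix (Fin m) (Fin m) (EvenGrassmann m))
    (a b : Fin n) :
    ((fubiniStudy (m := m) R k w).toBlocks₁₂ * K.map (EvenGrassmann m).val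
      * (fubiniStudy (m := m) R k w).toBlocks₂₁) a b
      = ((algebraMap ℂ (EvenGrassmann m) ((R : ℂ) ^ 4 * (star (w a) * w b))
        * invN m (bodySq w) ^ 4 * (K * oddMatrix m).trace : EvenGrassmann m) : Grassmann m) := by
  have hval : ∀ x : EvenGrassmann m, (x : Grassmann m) = (EvenGrassmann m).val x := fun x => rfl
  rw [hval, map_mul, Matrix.trace, map_sum, Finset.mul_sum, Matrix.mul_apply]
  simp only [Matrix.mul_apply, Matrix.diag_apply, map_sum, Finset.mul_sum, Finset.sum_mul]
  rw [Finset.sum_comm]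
  refine Finset.sum_congr rfl fun ν _ => Finset.sum_congr rfl fun μ _ => ?_
  simp only [Matrix.toBlocks₁₂, Matrix.toBlocks₂₁, Matrix.of_apply, fubiniStudy_inl_inr,
    fubiniStudy_inr_inl, Matrix.map_apply, oddMatrix]
  set X : EvenGrassmann m := ((R : ℂ) ^ 2 * Complex.I * star (w a)) • invN m (bodySq w) ^ 2 with hX
  set Y : EvenGrassmann m := ((R : ℂ) ^ 2 * Complex.I * w b) • invN m (bodySq w) ^ 2 with hY
  change (X : Grassmann m) * theta ν * (K ν μ : Grassmann m) * -((Y : Grassmann m) * thetaBar μ) = _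
  rw [mul_neg, mul_assoc _ (theta ν), ← even_commute (K ν μ).2, ← mul_assoc (X : Grassmann m),
    show (X : Grassmann m) * (K ν μ : Grassmann m) = ((X * K ν μ : EvenGrassmann m) : Grassmann m)
      from rfl, even_mul_even_mul]
  rw [← map_mul (EvenGrassmann m).val]
  change (EvenGrassmann m).val (-(X * K ν μ * Y * thetaThetaBar ν μ)) = _
  congr 1
  have h2 : algebraMap ℂ (EvenGrassmann m) Complex.I * algebraMap ℂ _ Complex.I = -1 := by
    rw [← map_mul, Complex.I_mul_I, map_neg, map_one]
  rw [hX, hY]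
  simp only [Algebra.smul_def, map_mul, map_pow]
  linear_combination (-(algebraMap ℂ (EvenGrassmann m) (R : ℂ)) ^ 4
    * algebraMap ℂ (EvenGrassmann m) (star (w a)) * algebraMap ℂ (EvenGrassmann m) (w b)
    * invN m (bodySq w) ^ 4 * K ν μ * thetaThetaBar ν μ) * h2

/-- The odd directions change the coefficient of -R² w̄^a w^b from 1/N² to 1/N² + τ/(rN²) = 1/(rN),
so nilpotents remain only in the overall factor R²/N. -/
theorem fubiniStudy_schur (hR : R ≠ 0) :
    (fubiniStudy (m := m) R k w).toBlocks₁₁ - (fubiniStudy (m := m) R k w).toBlocks₁₂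
        * (oddBlockInv m R (bodySq w)).map (EvenGrassmann m).val
        * (fubiniStudy (m := m) R k w).toBlocks₂₁
      = (evenSchur m R w).map (EvenGrassmann m).val := by
  have hR' : (R : ℂ) ≠ 0 := by exact_mod_cast hR
  have hr := (bodySq_pos w).ne'
  have hr' : (bodySq w : ℂ) ≠ 0 := by exact_mod_cast hr
  ext a b
  rw [Matrix.sub_apply, toBlocks₁₂_mul_mul_toBlocks₂₁]
  simp only [Matrix.toBlocks₁₁, Matrix.of_apply, Matrix.map_apply]
  rw [fubiniStudy_inl_inl]
  change _ = ((evenSchur m R w a b : EvenGrassmann m) : Grassmann m)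
  rw [← AddSubgroupClass.coe_sub]
  congr 1
  have hv := invN_mul (m := m) hr
  have h2 : algebraMap ℂ (EvenGrassmann m) Complex.I * algebraMap ℂ _ Complex.I = -1 := by
    rw [← map_mul, Complex.I_mul_I, map_neg, map_one]
  have h3 : algebraMap ℂ (EvenGrassmann m) (bodySq w : ℂ) * algebraMap ℂ _ (bodySq w : ℂ)⁻¹ = 1 := by
    rw [← map_mul, mul_inv_cancel₀ hr', map_one]
  have ht : (oddBlockInv m R (bodySq w) * oddMatrix m).trace
      = algebraMap ℂ (EvenGrassmann m) ((R : ℂ) ^ 2)⁻¹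
        * (algebraMap ℂ (EvenGrassmann m) (bodySq w : ℂ) + tau m) ^ 2 * tau m
        * algebraMap ℂ (EvenGrassmann m) (bodySq w : ℂ)⁻¹ := by
    rw [oddBlockInv, Matrix.smul_mul, Matrix.sub_mul, Matrix.one_mul, Matrix.smul_mul,
      mul_self_of_anticomm _ oddMatrix_anticomm, Matrix.trace_smul, Matrix.trace_sub,
      Matrix.trace_smul, Matrix.trace_neg, Matrix.trace_smul, trace_oddMatrix,
      Algebra.smul_def Complex.I (tau m)]
    simp only [smul_eq_mul, map_mul]
    linear_combination (-(algebraMap ℂ (EvenGrassmann m) ((R : ℂ) ^ 2)⁻¹)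
      * (algebraMap ℂ (EvenGrassmann m) (bodySq w : ℂ) + tau m) * tau m
      * (1 + (1 - algebraMap ℂ (EvenGrassmann m) Complex.I
        * algebraMap ℂ (EvenGrassmann m) Complex.I) * tau m
          * algebraMap ℂ (EvenGrassmann m) (bodySq w : ℂ)⁻¹)) * h2
      - (algebraMap ℂ (EvenGrassmann m) ((R : ℂ) ^ 2)⁻¹
      * (algebraMap ℂ (EvenGrassmann m) (bodySq w : ℂ) + tau m) * tau m) * h3
  rw [ht]
  simp only [evenSchur, Matrix.smul_apply, Matrix.sub_apply, smul_eq_mul, Matrix.one_apply,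
    Matrix.of_apply, Matrix.map_apply, map_sub]
  simp only [Algebra.smul_def, map_mul]
  have hR4 : algebraMap ℂ (EvenGrassmann m) ((R : ℂ) ^ 4)
      * algebraMap ℂ (EvenGrassmann m) ((R : ℂ) ^ 2)⁻¹
      = algebraMap ℂ (EvenGrassmann m) ((R : ℂ) ^ 2) := by
    rw [← map_mul]
    congr 1
    field_simp
  set δ := algebraMap ℂ (EvenGrassmann m) (if a = b then 1 else 0)
  set ρ := algebraMap ℂ (EvenGrassmann m) (bodySq w : ℂ)
  set ρ' := algebraMap ℂ (EvenGrassmann m) (bodySq w : ℂ)⁻¹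
  set u := algebraMap ℂ (EvenGrassmann m) (star (w a)) * algebraMap ℂ (EvenGrassmann m) (w b)
  set v := invN m (bodySq w)
  have hv4 : v ^ 4 * (ρ + tau m) ^ 2 = v ^ 2 := by
    linear_combination (v ^ 2 * (v * (ρ + tau m) + 1)) * hv
  linear_combination (-u * v ^ 4 * (ρ + tau m) ^ 2 * tau m * ρ') * hR4
    - (algebraMap ℂ (EvenGrassmann m) ((R : ℂ) ^ 2) * u * tau m * ρ') * hv4
    - (algebraMap ℂ (EvenGrassmann m) ((R : ℂ) ^ 2) * u * v * ρ') * hv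
    + (algebraMap ℂ (EvenGrassmann m) ((R : ℂ) ^ 2) * u * v ^ 2) * h3

/-- Here det S = R^{2n} N^{-n}/r and det H = (-iR²)^m N^{1-m}/r. In the quotient r cancels, and the
extra factor N from the odd determinant produces the exponent m - n - 1. -/
theorem sqrtBer_tensorMatrix_fubiniStudy {α β : ℂ} (hαβ : 4 * (α * β) = 1) (hR : 0 < R) :
    sqrtBer (tensorMatrix α β (fubiniStudy (m := m) R k w))
      = (evalTau m (fun x => R ^ (2 * ((n : ℤ) - m)) * x ^ ((m : ℤ) - n - 1)) (bodySq w) :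
        Grassmann m) := by
  have hr := (bodySq_pos w).ne'
  set X := evalTau m (fun x => R ^ (2 * ((n : ℤ) - m)) * x ^ ((m : ℤ) - n - 1)) (bodySq w) with hX
  suffices h : ber (tensorMatrix α β (fubiniStudy (m := m) R k w)) = X ^ 2 by
    rw [sqrtBer, h, hX]
    refine superEval_sqrt_sq ?_
    have := bodySq_pos w
    positivity
  rw [ber_tensorMatrix hαβ _ (oddBlock m R (bodySq w)) (oddBlockInv m R (bodySq w))
    (evenSchur m R w) (fubiniStudy_toBlocks₂₂ k w) (oddBlock_mul_oddBlockInv hR.ne' hr)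
    (fubiniStudy_schur k w hR.ne')]
  · have hunit : IsUnit (oddBlock m R (bodySq w)).det :=
      isUnit_iff_exists_inv.mpr ⟨(oddBlockInv m R (bodySq w)).det, by
        rw [← Matrix.det_mul, oddBlock_mul_oddBlockInv hR.ne' hr, Matrix.det_one]⟩
    have hunit' : IsUnit ((-1) ^ m * (oddBlock m R (bodySq w)).det ^ 2) :=
      (isUnit_one.neg.pow m).mul (hunit.pow 2)
    have hmain : X * (oddBlock m R (bodySq w)).det
        = algebraMap ℂ (EvenGrassmann m) (-Complex.I) ^ m * (evenSchur m R w).det := by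
      have hv : IsUnit (invN m (bodySq w) * algebraMap ℂ (EvenGrassmann m) (bodySq w : ℂ)) :=
        (isUnit_iff_exists_inv.mpr ⟨_, invN_mul (m := m) hr⟩).mul
          ((IsUnit.mk0 (bodySq w : ℂ) (by exact_mod_cast hr)).map (algebraMap ℂ (EvenGrassmann m)))
      apply hv.mul_right_cancel
      have hX2 : X = algebraMap ℂ (EvenGrassmann m) ((R ^ (2 * ((n : ℤ) - m)) : ℝ) : ℂ)
          * evalTau m (fun x => x ^ ((m : ℤ) - n - 1)) (bodySq w) := by
        rw [← Algebra.smul_def]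
        exact taylorAt_smul _
      have hZ : evalTau m (fun x => x ^ ((m : ℤ) - n - 1)) (bodySq w) * invN m (bodySq w) ^ m
          = invN m (bodySq w) ^ (n + 1) := by
        rw [invN_pow hr, invN_pow hr, ← evalTau_zpow_add hr]
        congr 2
        funext x
        congr 1
        push_cast
        ring
      have hRR : algebraMap ℂ (EvenGrassmann m) ((R ^ (2 * ((n : ℤ) - m)) : ℝ) : ℂ)
          * algebraMap ℂ (EvenGrassmann m) ((R : ℂ) ^ 2) ^ m
          = algebraMap ℂ (EvenGrassmann m) ((R : ℂ) ^ 2) ^ n := by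
        rw [← map_pow, ← map_pow, ← map_mul]
        congr 1
        have : R ^ (2 * ((n : ℤ) - m)) * (R ^ 2) ^ m = (R ^ 2) ^ n := by
          rw [← pow_mul, ← pow_mul, ← zpow_natCast, ← zpow_natCast, ← zpow_add₀ hR.ne']
          congr 1
          push_cast
          ring
        exact_mod_cast this
      calc X * (oddBlock m R (bodySq w)).det
            * (invN m (bodySq w) * algebraMap ℂ (EvenGrassmann m) (bodySq w : ℂ))
          = X * (algebraMap ℂ (EvenGrassmann m) (-Complex.I) ^ m
            * algebraMap ℂ (EvenGrassmann m) ((R : ℂ) ^ 2) ^ m * invN m (bodySq w) ^ m) := by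
            rw [mul_assoc, det_oddBlock hr, ← neg_mul, map_mul, mul_pow, mul_pow]
        _ = algebraMap ℂ (EvenGrassmann m) (-Complex.I) ^ m
            * (algebraMap ℂ (EvenGrassmann m) ((R : ℂ) ^ 2) * invN m (bodySq w)) ^ n
              * invN m (bodySq w) := by
            rw [hX2, mul_pow, ← hRR]
            linear_combination (algebraMap ℂ (EvenGrassmann m) (-Complex.I) ^ m
              * algebraMap ℂ (EvenGrassmann m) ((R ^ (2 * ((n : ℤ) - m)) : ℝ) : ℂ)
              * algebraMap ℂ (EvenGrassmann m) ((R : ℂ) ^ 2) ^ m) * hZ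
        _ = _ := by rw [← det_evenSchur]; ring
    symm
    rw [Ring.eq_mul_inverse_iff_mul_eq _ _ _ hunit']
    -- The phase (-i)^m of det H squares to (-1)^m and cancels the Koszul sign, so the Berezinian is
    -- the square of an element with positive body.
    have hI : (-1 : EvenGrassmann m) ^ m * (algebraMap ℂ (EvenGrassmann m) (-Complex.I) ^ m) ^ 2
        = 1 := by
      rw [← pow_mul, mul_comm m 2, pow_mul, ← map_pow, ← mul_pow, neg_sq, Complex.I_sq, map_neg,
        map_one, neg_one_mul, neg_neg, one_pow]
    calc X ^ 2 * ((-1) ^ m * (oddBlock m R (bodySq w)).det ^ 2)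
        = (-1) ^ m * (X * (oddBlock m R (bodySq w)).det) ^ 2 := by ring
      _ = (-1) ^ m * (algebraMap ℂ (EvenGrassmann m) (-Complex.I) ^ m) ^ 2
          * (evenSchur m R w).det ^ 2 := by rw [hmain]; ring
      _ = _ := by rw [hI, one_mul]
  · intro a μ ν b
    simp only [Matrix.toBlocks₁₂, Matrix.toBlocks₂₁, Matrix.of_apply, fubiniStudy_inl_inr,
      fubiniStudy_inr_inl]
    set X : EvenGrassmann m := ((R : ℂ) ^ 2 * Complex.I * star (w a)) • invN m (bodySq w) ^ 2
    set Y : EvenGrassmann m := ((R : ℂ) ^ 2 * Complex.I * w b) • invN m (bodySq w) ^ 2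
    change (X : Grassmann m) * theta μ * -((Y : Grassmann m) * thetaBar ν)
      = -(-((Y : Grassmann m) * thetaBar ν) * ((X : Grassmann m) * theta μ))
    rw [mul_neg, even_mul_even_mul, neg_mul, even_mul_even_mul, theta_mul_thetaBar,
      even_commute X.2, mul_neg]

/-- The volume element `R^{2(n-m)} N^{-(n+1-m)}`. -/
theorem riemannianVolumeElement_eq (hR : 0 < R) :
    riemannianVolumeElement n m R k w = (((R ^ (2 * ((n : ℤ) - m)) : ℝ) : ℂ) •
      evalTau m (fun x => x ^ ((m : ℤ) - n - 1)) (bodySq w) : EvenGrassmann m) := by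
  rw [riemannianVolumeElement, reMatrix_eq_tensorMatrix,
    sqrtBer_tensorMatrix_fubiniStudy k w (by norm_num) hR]
  congr 1
  exact taylorAt_smul _

theorem liouvilleVolumeElement_eq (hR : 0 < R) :
    liouvilleVolumeElement n m R k w = (((R ^ (2 * ((n : ℤ) - m)) : ℝ) : ℂ) •
      evalTau m (fun x => x ^ ((m : ℤ) - n - 1)) (bodySq w) : EvenGrassmann m) := by
  rw [liouvilleVolumeElement, negImMatrix_eq_tensorMatrix,
    sqrtBer_tensorMatrix_fubiniStudy k w (by linear_combination -Complex.I_mul_I) hR]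
  congr 1
  exact taylorAt_smul _

end VolumeElement

section HomogeneousIntegration

variable {n m : ℕ}

/-! ### Homogeneous integration

Integrals over an affine chart are compared with Gaussian integrals over `ℂ^{n+1}`. -/

theorem integral_normSq_pow_mul_exp (j : ℕ) {b : ℝ} (hb : 0 < b) :
    ∫ u : ℂ, Complex.normSq u ^ j * Real.exp (-(b * Complex.normSq u))
      = Real.pi * j.factorial / b ^ (j + 1) := by
  have h := Complex.integral_rpow_mul_exp_neg_mul_rpow (p := 2) (q := 2 * j) one_le_two
    (by have : (0 : ℝ) ≤ j := Nat.cast_nonneg j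
        linarith) hb
  have e1 : (-(2 * (j : ℝ) + 2) / 2) = -((j + 1 : ℕ) : ℝ) := by push_cast; ring
  have e2 : ((2 * (j : ℝ) + 2) / 2) = (j : ℝ) + 1 := by ring
  rw [e1, e2, Real.Gamma_nat_eq_factorial, Real.rpow_neg hb.le, Real.rpow_natCast] at h
  rw [show Real.pi * j.factorial / b ^ (j + 1)
    = 2 * Real.pi / 2 * (b ^ (j + 1))⁻¹ * j.factorial by field_simp, ← h]
  refine integral_congr_ae (Filter.Eventually.of_forall fun u => ?_)
  simp only
  rw [Complex.normSq_eq_norm_sq, Real.rpow_mul (norm_nonneg u), Real.rpow_natCast, Real.rpow_two,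
    neg_mul]

theorem lintegral_normSq_pow_mul_exp (j : ℕ) {b : ℝ} (hb : 0 < b) :
    ∫⁻ u : ℂ, ENNReal.ofReal (Complex.normSq u ^ j * Real.exp (-(b * Complex.normSq u)))
      = ENNReal.ofReal (Real.pi * j.factorial / b ^ (j + 1)) := by
  have h := integral_normSq_pow_mul_exp j hb
  rw [← h, ofReal_integral_eq_lintegral_ofReal]
  -- A non-integrable function has integral 0, so the nonzero value already found proves
  -- integrability.
  · by_contra hint
    rw [integral_undef hint] at h
    have : 0 < Real.pi * j.factorial / b ^ (j + 1) := by positivity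
    exact this.ne h
  · exact Filter.Eventually.of_forall fun u =>
      mul_nonneg (pow_nonneg (Complex.normSq_nonneg u) j) (Real.exp_pos _).le

theorem lintegral_comp_div {u : ℂ} (hu : u ≠ 0) {f : (Fin n → ℂ) → ENNReal} (hf : Measurable f) :
    ∫⁻ v : Fin n → ℂ, f (fun b => v b / u)
      = ENNReal.ofReal (Complex.normSq u ^ n) * ∫⁻ v : Fin n → ℂ, f v := by
  set L : (Fin n → ℂ) →ₗ[ℝ] (Fin n → ℂ) :=
    (u⁻¹ • (LinearMap.id : (Fin n → ℂ) →ₗ[ℂ] (Fin n → ℂ))).restrictScalars ℝ with hL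
  have hLv : ∀ v, L v = fun b => v b / u := by
    intro v
    funext b
    simp [hL, div_eq_inv_mul]
  have hdet : LinearMap.det L = (Complex.normSq u ^ n)⁻¹ := by
    rw [hL, LinearMap.det_restrictScalars, LinearMap.det_smul, LinearMap.det_id, mul_one,
      Algebra.norm_complex_apply, Module.finrank_fin_fun, map_pow, Complex.normSq_inv, inv_pow]
  have hpos : 0 < Complex.normSq u ^ n := pow_pos (Complex.normSq_pos.mpr hu) n
  have hmap := Measure.map_linearMap_addHaar_eq_smul_addHaar (volume : Measure (Fin n → ℂ))
    (f := L) (by rw [hdet]; positivity)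
  have hLm : Measurable L := L.continuous_of_finiteDimensional.measurable
  have h := lintegral_map (μ := (volume : Measure (Fin n → ℂ))) hf hLm
  rw [hmap, hdet, inv_inv, abs_of_pos hpos, lintegral_smul_measure] at h
  simp only [hLv] at h
  exact h.symm

/-- The Gaussian measure `exp (-∑ |z^a|²) dz`, not normalized. -/
def gaussian (n : ℕ) : Measure (Fin (n + 1) → ℂ) :=
  volume.withDensity fun z => ENNReal.ofReal (Real.exp (-∑ a, Complex.normSq (z a)))

/-- The affine coordinates `z^a / z^k`. -/
def affine (k : Fin (n + 1)) (z : Fin (n + 1) → ℂ) : Fin n → ℂ := fun b => z (k.succAbove b) / z k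

theorem affine_insertNth (k : Fin (n + 1)) (u : ℂ) (v : Fin n → ℂ) :
    affine k (k.insertNth u v) = fun b => v b / u := by
  funext b
  simp [affine]

theorem measurable_affine (k : Fin (n + 1)) : Measurable (affine k) :=
  measurable_pi_iff.mpr fun _ => (measurable_pi_apply _).div (measurable_pi_apply _)

theorem measurable_bodySq : Measurable (bodySq : (Fin n → ℂ) → ℝ) :=
  measurable_const.add (Finset.measurable_sum _ fun a _ =>
    Complex.continuous_normSq.measurable.comp (measurable_pi_apply a))

theorem measurable_gaussianDensity :
    Measurable fun z : Fin (n + 1) → ℂ =>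
      ENNReal.ofReal (Real.exp (-∑ a, Complex.normSq (z a))) :=
  (Real.measurable_exp.comp (Finset.measurable_sum _ fun a _ =>
    Complex.continuous_normSq.measurable.comp (measurable_pi_apply a)).neg).ennreal_ofReal

theorem measurable_chartDensity :
    Measurable fun w : Fin n → ℂ =>
      ENNReal.ofReal (Real.pi * n.factorial / bodySq w ^ (n + 1)) :=
  (measurable_const.div (measurable_bodySq.pow_const _)).ennreal_ofReal

/-- Put u = z^k and let the other coordinates be u w: the Jacobian is |u|^{2n} and the exponent -r
|u|², so integrating over u leaves π n!/r^{n+1}. The density is the same for every k. -/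
theorem map_affine_gaussian (k : Fin (n + 1)) :
    (gaussian n).map (affine k) = volume.withDensity fun w =>
      ENNReal.ofReal (Real.pi * n.factorial / bodySq w ^ (n + 1)) := by
  refine Measure.ext_of_lintegral _ fun f hf => ?_
  rw [lintegral_map hf (measurable_affine k), gaussian,
    lintegral_withDensity_eq_lintegral_mul _ measurable_gaussianDensity
      (show Measurable fun z => f (affine k z) from hf.comp (measurable_affine k)),
    lintegral_withDensity_eq_lintegral_mul _ measurable_chartDensity hf]
  set h : (Fin (n + 1) → ℂ) → ENNReal :=
    (fun z => ENNReal.ofReal (Real.exp (-∑ a, Complex.normSq (z a)))) * fun a => f (affine k a)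
    with hh
  have hhm : Measurable h := measurable_gaussianDensity.mul (hf.comp (measurable_affine k))
  have hvp := (volume_preserving_piFinSuccAbove (fun _ : Fin (n + 1) => ℂ) k).symm
  have h1 : ∫⁻ z, h z = ∫⁻ p : ℂ × (Fin n → ℂ), ENNReal.ofReal (Real.exp
      (-(Complex.normSq p.1 + ∑ a, Complex.normSq (p.2 a)))) * f (fun b => p.2 b / p.1) := by
    rw [← hvp.lintegral_comp hhm]
    refine lintegral_congr fun p => ?_
    rw [hh, Pi.mul_apply]
    simp only [MeasurableEquiv.piFinSuccAbove_symm_apply, Fin.insertNthEquiv,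
      Fin.sum_univ_succAbove _ k]
    simp [affine_insertNth]
  have hfc : Measurable fun p : ℂ × (Fin n → ℂ) => f fun b => p.2 b / p.1 :=
    hf.comp (measurable_pi_iff.mpr fun b =>
      ((measurable_pi_apply b).comp measurable_snd).div measurable_fst)
  have hsum : Measurable fun v : Fin n → ℂ => ∑ a, Complex.normSq (v a) :=
    Finset.measurable_sum _ fun a _ =>
      Complex.continuous_normSq.measurable.comp (measurable_pi_apply a)
  have hsq : Measurable Complex.normSq := Complex.continuous_normSq.measurable
  rw [h1, Measure.volume_eq_prod, lintegral_prod]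
  · have h2 : ∀ᵐ u : ℂ, ∫⁻ v : Fin n → ℂ, ENNReal.ofReal (Real.exp
        (-(Complex.normSq u + ∑ a, Complex.normSq (v a)))) * f (fun b => v b / u)
        = ∫⁻ v : Fin n → ℂ, ENNReal.ofReal (Complex.normSq u ^ n
          * Real.exp (-(bodySq v * Complex.normSq u))) * f v := by
      -- The substitution divides by u, so the null set u = 0 is discarded.
      filter_upwards [compl_mem_ae_iff.mpr (measure_singleton (0 : ℂ))] with u hu
      have hu0 : u ≠ 0 := hu
      have hH : Measurable fun v : Fin n → ℂ =>
          ENNReal.ofReal (Real.exp (-(bodySq v * Complex.normSq u))) * f v :=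
        ((Real.measurable_exp.comp (measurable_bodySq.mul_const _).neg).ennreal_ofReal).mul hf
      have h3 := lintegral_comp_div hu0 hH
      rw [← lintegral_const_mul _ hH] at h3
      refine Eq.trans (lintegral_congr fun v => ?_) (h3.trans (lintegral_congr fun v => ?_))
      · congr 4
        have : Complex.normSq u ≠ 0 := (Complex.normSq_pos.mpr hu0).ne'
        simp only [bodySq, Complex.normSq_div, ← Finset.sum_div]
        field_simp
      · rw [← mul_assoc, ← ENNReal.ofReal_mul (pow_nonneg (Complex.normSq_nonneg u) n)]
    rw [lintegral_congr_ae h2, lintegral_lintegral_swap]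
    · refine lintegral_congr fun v => ?_
      rw [lintegral_mul_const, lintegral_normSq_pow_mul_exp n (bodySq_pos v)]
      · rfl
      · exact ((hsq.pow_const n).mul
          (Real.measurable_exp.comp (hsq.const_mul _).neg)).ennreal_ofReal
    · refine Measurable.aemeasurable ?_
      exact (((hsq.comp measurable_fst).pow_const n).mul (Real.measurable_exp.comp
        ((measurable_bodySq.comp measurable_snd).mul (hsq.comp measurable_fst)).neg)).ennreal_ofReal.mul
        (hf.comp measurable_snd)
  · exact ((Real.measurable_exp.comp ((hsq.comp measurable_fst).add
      (hsum.comp measurable_snd)).neg).ennreal_ofReal.mul hfc).aemeasurable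

theorem gaussian_univ : gaussian n Set.univ = ENNReal.ofReal (Real.pi ^ (n + 1)) := by
  have hone : ∫ u : ℂ, Real.exp (-Complex.normSq u) = Real.pi := by
    simpa using integral_normSq_pow_mul_exp 0 one_pos
  have h1 : ∫ z : Fin (n + 1) → ℂ, Real.exp (-∑ a, Complex.normSq (z a)) = Real.pi ^ (n + 1) := by
    have := integral_fintype_prod_volume_eq_pow (ι := Fin (n + 1))
      (fun u : ℂ => Real.exp (-Complex.normSq u))
    rw [hone, Fintype.card_fin] at this
    rw [← this]
    refine integral_congr_ae (Filter.Eventually.of_forall fun z => ?_)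
    simp only
    rw [← Real.exp_sum, Finset.sum_neg_distrib]
  rw [gaussian, withDensity_apply _ MeasurableSet.univ, Measure.restrict_univ, ← h1,
    ofReal_integral_eq_lintegral_ofReal]
  · by_contra hint
    rw [integral_undef hint] at h1
    have : 0 < Real.pi ^ (n + 1) := by positivity
    exact this.ne h1
  · exact Filter.Eventually.of_forall fun z => (Real.exp_pos _).le

end HomogeneousIntegration

section ChartChange

variable {n m : ℕ}

/-! ### Change of charts -/

theorem homog_self (k : Fin (n + 1)) (w : Fin n → ℂ) : homog k w k = 1 := by
  simp [homog]

theorem homog_succAbove (k : Fin (n + 1)) (w : Fin n → ℂ) (b : Fin n) :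
    homog k w (k.succAbove b) = w b := by
  simp [homog]

theorem sum_normSq_homog (k : Fin (n + 1)) (w : Fin n → ℂ) :
    ∑ a, Complex.normSq (homog k w a) = bodySq w := by
  rw [Fin.sum_univ_succAbove _ k, homog_self, map_one, bodySq]
  simp only [homog_succAbove]

theorem homog_transition {k l : Fin (n + 1)} {w : Fin n → ℂ} (h : homog k w l ≠ 0)
    (a : Fin (n + 1)) :
    homog l (transition k l w) a = homog k w a * (homog k w l)⁻¹ := by
  rcases Fin.eq_self_or_eq_succAbove l a with rfl | ⟨b, rfl⟩
  · rw [homog_self, mul_inv_cancel₀ h]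
  · rw [homog_succAbove, transition, div_eq_mul_inv]

theorem bodySq_transition {k l : Fin (n + 1)} {w : Fin n → ℂ} (h : homog k w l ≠ 0) :
    bodySq (transition k l w) = Complex.normSq (homog k w l)⁻¹ * bodySq w := by
  rw [← sum_normSq_homog l, ← sum_normSq_homog k, Finset.mul_sum]
  refine Finset.sum_congr rfl fun a _ => ?_
  rw [homog_transition h, map_mul, mul_comm]

theorem homog_affine {k : Fin (n + 1)} {z : Fin (n + 1) → ℂ} (h : z k ≠ 0) (a : Fin (n + 1)) :
    homog k (affine k z) a = z a / z k := by
  rcases Fin.eq_self_or_eq_succAbove k a with rfl | ⟨b, rfl⟩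
  · rw [homog_self, div_self h]
  · rw [homog_succAbove, affine]

theorem transition_affine {k : Fin (n + 1)} (l : Fin (n + 1)) {z : Fin (n + 1) → ℂ} (h : z k ≠ 0) :
    transition k l (affine k z) = affine l z := by
  funext b
  rw [transition, homog_affine h, homog_affine h, affine, div_div_div_cancel_right₀ h]

/-- Homogeneity of x^q survives truncation: the j-th derivative scales with degree q - j and t^j
supplies the missing s^j. -/
theorem taylorAt_zpow_smul {A : Type*} [Ring A] [Algebra ℂ A] (t : A) (K : ℕ) (q : ℤ) {s : ℝ}
    (hs : s ≠ 0) (r : ℝ) :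
    taylorAt ((s : ℂ) • t) K (fun x => x ^ q) (s * r)
      = ((s ^ q : ℝ) : ℂ) • taylorAt t K (fun x => x ^ q) r := by
  unfold taylorAt
  rw [Finset.smul_sum]
  refine Finset.sum_congr rfl fun j _ => ?_
  rw [smul_pow, smul_smul, smul_smul, ← Complex.ofReal_pow, ← Complex.ofReal_mul,
    ← Complex.ofReal_mul]
  congr 2
  rw [iteratedDeriv_eq_iterate, iter_deriv_zpow, iter_deriv_zpow, mul_zpow]
  have : s ^ q = s ^ (q - j) * s ^ j := by
    rw [← zpow_natCast s j, ← zpow_add₀ hs, sub_add_cancel]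
  rw [this]
  ring

theorem oddScale_evalTau_zpow {c : ℂ} (hc : c ≠ 0) (q : ℤ) (r : ℝ) :
    oddScale c (evalTau m (fun x => x ^ q) (Complex.normSq c * r) : Grassmann m)
      = ((Complex.normSq c ^ q : ℝ) : ℂ) • (evalTau m (fun x => x ^ q) r : Grassmann m) := by
  rw [coe_evalTau, coe_evalTau, map_taylorAt, oddScale_tau,
    taylorAt_zpow_smul _ _ _ (Complex.normSq_pos.mpr hc).ne']

/-- The Berezin integrand `(1 + |w|²)^{n+1} ∫ D(ξ, η) f N^{m-n-1}`, relative to the unitarily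
invariant volume of projective space. -/
def invariantIntegrand (f : ChartFun n m) (w : Fin n → ℂ) : ℂ :=
  ((bodySq w ^ (n + 1) : ℝ) : ℂ) *
    oddIntegral (f w * (evalTau m (fun x => x ^ ((m : ℤ) - n - 1)) (bodySq w) : Grassmann m))

/-- With s = |c|², r^{n+1} contributes s^{n+1}, the power of N contributes s^{m-n-1}, and the odd
integral s^m; the exponents balance because (n+1) + (m-n-1) = m. -/
theorem invariantIntegrand_transition (f : GlobalFun n m) {k l : Fin (n + 1)} {w : Fin n → ℂ}
    (h : homog k w l ≠ 0) :
    invariantIntegrand (f.toFun k) w = invariantIntegrand (f.toFun l) (transition k l w) := by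
  set c := (homog k w l)⁻¹ with hc
  have hc0 : c ≠ 0 := inv_ne_zero h
  set s := Complex.normSq c with hs
  have hs0 : s ≠ 0 := (Complex.normSq_pos.mpr hc0).ne'
  set q : ℤ := (m : ℤ) - n - 1 with hq
  have h1 : oddScale c (f.toFun l (transition k l w)
      * (evalTau m (fun x => x ^ q) (s * bodySq w) : Grassmann m))
      = ((s ^ q : ℝ) : ℂ) • (f.toFun k w * (evalTau m (fun x => x ^ q) (bodySq w) : Grassmann m)) := by
    rw [map_mul, oddScale_evalTau_zpow hc0, mul_smul_comm, f.compatible k l w h]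
    rfl
  have h2 := congrArg oddIntegral h1
  rw [oddIntegral_oddScale, map_smul, smul_eq_mul, ← hs] at h2
  rw [invariantIntegrand, invariantIntegrand, bodySq_transition h, ← hc, ← hs, mul_pow,
    ← hq, Complex.ofReal_mul]
  have h3 : ((s ^ (n + 1) : ℝ) : ℂ) * ((s ^ q : ℝ) : ℂ) = (s : ℂ) ^ m := by
    rw [← Complex.ofReal_mul, ← Complex.ofReal_pow, ← zpow_natCast, ← zpow_natCast,
      ← zpow_add₀ hs0, hq]
    congr 2
    push_cast
    ring
  have h4 : ((s ^ q : ℝ) : ℂ) ≠ 0 := Complex.ofReal_ne_zero.mpr (zpow_ne_zero _ hs0)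
  apply mul_left_cancel₀ h4
  rw [mul_left_comm, ← h2, ← h3]
  ring

/-! ### Integrability -/

theorem continuous_bodySq : Continuous (bodySq : (Fin n → ℂ) → ℝ) :=
  continuous_const.add (continuous_finsetSum _ fun a _ =>
    Complex.continuous_normSq.comp (continuous_apply a))

theorem continuous_oddIntegral_mul {f : ChartFun n m} (hf : IsSmooth f) (q : ℤ) :
    Continuous fun w => oddIntegral (f w * (evalTau m (fun x => x ^ q) (bodySq w) : Grassmann m)) := by
  have h1 : (fun w => oddIntegral (f w * (evalTau m (fun x => x ^ q) (bodySq w) : Grassmann m)))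
      = fun w => ∑ s, ∑ j ∈ Finset.range (2 * m + 1), (monomials m).repr (f w) s *
        (((iteratedDeriv j (fun x : ℝ => x ^ q) (bodySq w) / (j.factorial : ℝ) : ℝ) : ℂ)
          * oddIntegral (monomials m s * (tau m : Grassmann m) ^ j)) := by
    funext w
    conv_lhs => rw [← (monomials m).sum_repr (f w)]
    rw [coe_evalTau, taylorAt]
    simp only [Finset.sum_mul, Finset.mul_sum, map_sum, smul_mul_assoc, mul_smul_comm, map_smul,
      smul_eq_mul]
    rw [Finset.sum_comm]
    refine Finset.sum_congr rfl fun s _ => Finset.sum_congr rfl fun j _ => ?_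
    ring
  rw [h1]
  refine continuous_finsetSum _ fun s _ => continuous_finsetSum _ fun j _ =>
    (hf s).continuous.mul ((Complex.continuous_ofReal.comp (Continuous.div_const ?_ _)).mul
      continuous_const)
  simp only [iteratedDeriv_eq_iterate, iter_deriv_zpow]
  exact continuous_const.mul (continuous_bodySq.zpow₀ _ fun w => Or.inl (bodySq_pos w).ne')

theorem integrable_oddIntegral_mul {f : ChartFun n m} (hf : IsSmooth f)
    (hc : HasCompactSupport f) (q : ℤ) :
    Integrable fun w =>
      oddIntegral (f w * (evalTau m (fun x => x ^ q) (bodySq w) : Grassmann m)) := by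
  refine (continuous_oddIntegral_mul hf q).integrable_of_hasCompactSupport (hc.mono ?_)
  intro w hw
  rw [Function.mem_support] at hw ⊢
  contrapose! hw
  rw [hw, zero_mul, map_zero]

theorem integrable_invariantIntegrand_affine {f : ChartFun n m} (hf : IsSmooth f)
    (hc : HasCompactSupport f) (k : Fin (n + 1)) :
    Integrable (fun z => invariantIntegrand f (affine k z)) (gaussian n) ∧
    ∫ z, invariantIntegrand f (affine k z) ∂gaussian n = ((Real.pi * n.factorial : ℝ) : ℂ) *
      ∫ w, oddIntegral (f w *
        (evalTau m (fun x => x ^ ((m : ℤ) - n - 1)) (bodySq w) : Grassmann m)) := by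
  have hcont : Continuous (invariantIntegrand f) :=
    (Complex.continuous_ofReal.comp (continuous_bodySq.pow _)).mul
      (continuous_oddIntegral_mul hf _)
  have h1 : ∀ w : Fin n → ℂ, (ENNReal.ofReal
      (Real.pi * n.factorial / bodySq w ^ (n + 1))).toReal • invariantIntegrand f w
      = ((Real.pi * n.factorial : ℝ) : ℂ) * oddIntegral (f w *
        (evalTau m (fun x => x ^ ((m : ℤ) - n - 1)) (bodySq w) : Grassmann m)) := by
    intro w
    have hw := bodySq_pos w
    rw [ENNReal.toReal_ofReal (by positivity), invariantIntegrand, Complex.real_smul, ← mul_assoc,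
      ← Complex.ofReal_mul]
    congr 2
    field_simp
  have hlt : ∀ᵐ w : Fin n → ℂ, ENNReal.ofReal
      (Real.pi * n.factorial / bodySq w ^ (n + 1)) < ⊤ :=
    Filter.Eventually.of_forall fun w => ENNReal.ofReal_lt_top
  have hmeas := (measurable_affine k).aemeasurable (μ := gaussian n)
  constructor
  · rw [← Function.comp_def, ← integrable_map_measure hcont.aestronglyMeasurable hmeas,
      map_affine_gaussian, integrable_withDensity_iff_integrable_smul' measurable_chartDensity hlt]
    simp only [h1]
    exact (integrable_oddIntegral_mul hf hc _).const_mul _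
  · rw [← integral_map hmeas hcont.aestronglyMeasurable, map_affine_gaussian,
      integral_withDensity_eq_integral_toReal_smul measurable_chartDensity hlt]
    simp only [h1]
    exact integral_const_mul _ _

/-! ### Summation over a partition of unity -/

theorem ae_gaussian_ne_zero : ∀ᵐ z ∂gaussian n, ∀ a, z a ≠ 0 := by
  have h : ∀ᵐ z : Fin (n + 1) → ℂ, ∀ a, z a ≠ 0 := Filter.eventually_all.mpr fun a =>
    Measure.ae_eval_ne (μ := fun _ : Fin (n + 1) => (volume : Measure ℂ)) a 0
  exact (withDensity_absolutelyContinuous _ _).ae_le h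

theorem invariantIntegrand_one (w : Fin n → ℂ) :
    invariantIntegrand (fun _ => (1 : Grassmann m)) w
      = ((2 ^ m * n.factorial / Real.Gamma ((n : ℝ) - m + 1) : ℝ) : ℂ) := by
  rw [invariantIntegrand, one_mul, pow_mul_oddIntegral_evalTau_zpow n m (bodySq_pos w)]

/-- Each ρ_k is integrated in its own chart, so the sum cannot be collapsed there. On C^{n+1},
almost every z lies over all charts; invariance moves every integrand to chart 0, where linearity
and ∑ ρ_k = 1 leave a constant. -/
theorem sum_integral_partition (P : PartitionOfUnity n m) :
    ∑ k, ∫ w, oddIntegral ((P.ρ k).toFun k w *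
      (evalTau m (fun x => x ^ ((m : ℤ) - n - 1)) (bodySq w) : Grassmann m))
      = ((Real.pi ^ n * 2 ^ m / Real.Gamma ((n : ℝ) - m + 1) : ℝ) : ℂ) := by
  have h := fun k => integrable_invariantIntegrand_affine ((P.ρ k).smooth k) (P.compact_support k) k
  have hpi : ((Real.pi * n.factorial : ℝ) : ℂ) ≠ 0 := by
    have : Real.pi * n.factorial ≠ 0 := by positivity
    exact_mod_cast this
  apply mul_left_cancel₀ hpi
  rw [Finset.mul_sum, Finset.sum_congr rfl fun k _ => (h k).2.symm,
    ← integral_finsetSum _ fun k _ => (h k).1]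
  have hae : ∀ᵐ z ∂gaussian n, ∑ k, invariantIntegrand ((P.ρ k).toFun k) (affine k z)
      = ((2 ^ m * n.factorial / Real.Gamma ((n : ℝ) - m + 1) : ℝ) : ℂ) := by
    filter_upwards [ae_gaussian_ne_zero] with z hz
    rw [← invariantIntegrand_one (affine 0 z)]
    have h0 : ∀ k, invariantIntegrand ((P.ρ k).toFun k) (affine k z)
        = invariantIntegrand ((P.ρ k).toFun 0) (affine 0 z) := by
      intro k
      have hne : homog 0 (affine 0 z) k ≠ 0 := by
        rw [homog_affine (hz 0)]
        exact div_ne_zero (hz k) (hz 0)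
      rw [invariantIntegrand_transition (P.ρ k) hne, transition_affine k (hz 0)]
    rw [Finset.sum_congr rfl fun k _ => h0 k]
    simp only [invariantIntegrand]
    rw [← Finset.mul_sum, ← map_sum, ← Finset.sum_mul, P.sum_eq_one]
  rw [integral_congr_ae hae, integral_const, Measure.real, gaussian_univ,
    ENNReal.toReal_ofReal (by positivity), Complex.real_smul, ← Complex.ofReal_mul,
    ← Complex.ofReal_mul]
  congr 1
  ring

end ChartChange

section Volume

variable {n m : ℕ}

/-! ### Existence of partitions of unity -/

/-- The share `|z^a|² / ∑ |z^b|²` of a homogeneous coordinate in the Hermitian square. -/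
def weight (a l : Fin (n + 1)) (w : Fin n → ℂ) : ℝ := Complex.normSq (homog l w a) / bodySq w

theorem sum_weight (l : Fin (n + 1)) (w : Fin n → ℂ) : ∑ a, weight a l w = 1 := by
  simp only [weight]
  rw [← Finset.sum_div, sum_normSq_homog, div_self (bodySq_pos w).ne']

theorem weight_transition (a : Fin (n + 1)) {k l : Fin (n + 1)} {w : Fin n → ℂ}
    (h : homog k w l ≠ 0) : weight a l (transition k l w) = weight a k w := by
  have h1 : Complex.normSq (homog k w l)⁻¹ ≠ 0 := (Complex.normSq_pos.mpr (inv_ne_zero h)).ne'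
  rw [weight, weight, homog_transition h, bodySq_transition h, map_mul, mul_comm,
    mul_div_mul_left _ _ h1]

theorem contDiff_normSq : ContDiff ℝ ∞ Complex.normSq := by
  have : (Complex.normSq : ℂ → ℝ) = fun z => Complex.reCLM z * Complex.reCLM z
      + Complex.imCLM z * Complex.imCLM z := by
    funext z
    simp [Complex.normSq_apply]
  rw [this]
  fun_prop

theorem contDiff_homog (l a : Fin (n + 1)) : ContDiff ℝ ∞ fun w : Fin n → ℂ => homog l w a := by
  rcases Fin.eq_self_or_eq_succAbove l a with rfl | ⟨b, rfl⟩
  · simp only [homog_self]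
    exact contDiff_const
  · simp only [homog_succAbove]
    exact contDiff_apply ℝ ℂ b

theorem contDiff_weight (a l : Fin (n + 1)) : ContDiff ℝ ∞ (weight a l) := by
  have hb : ContDiff ℝ ∞ (bodySq : (Fin n → ℂ) → ℝ) :=
    contDiff_const.add (ContDiff.sum fun b _ => contDiff_normSq.comp (contDiff_apply ℝ ℂ b))
  exact (contDiff_normSq.comp (contDiff_homog l a)).div hb fun w => (bodySq_pos w).ne'

/-- A smooth function of the weight of a homogeneous coordinate, positive where this coordinate is
the largest one and zero where it is small. -/
def bump (a l : Fin (n + 1)) (w : Fin n → ℂ) : ℝ :=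
  Real.smoothTransition (weight a l w - 1 / (2 * (n + 1)))

theorem bump_eq_zero {a l : Fin (n + 1)} {w : Fin n → ℂ} (h : weight a l w ≤ 1 / (2 * (n + 1))) :
    bump a l w = 0 :=
  Real.smoothTransition.zero_of_nonpos (sub_nonpos.mpr h)

/-- Some weight is at least the average 1/(n+1), which exceeds the cutoff 1/(2(n+1)). -/
theorem sum_bump_pos (l : Fin (n + 1)) (w : Fin n → ℂ) : 0 < ∑ a, bump a l w := by
  obtain ⟨a, -, ha⟩ : ∃ a ∈ Finset.univ, 1 / ((n : ℝ) + 1) ≤ weight a l w := by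
    apply Finset.exists_le_of_sum_le Finset.univ_nonempty
    rw [sum_weight, Finset.sum_const, Finset.card_univ, Fintype.card_fin, nsmul_eq_mul]
    push_cast
    rw [mul_one_div_cancel (by positivity)]
  refine Finset.sum_pos' (fun b _ => Real.smoothTransition.nonneg _) ⟨a, Finset.mem_univ a, ?_⟩
  refine Real.smoothTransition.pos_of_pos (sub_pos.mpr (lt_of_lt_of_le ?_ ha))
  apply one_div_lt_one_div_of_lt <;> linarith [(Nat.cast_nonneg n : (0 : ℝ) ≤ n)]

/-- A smooth partition of unity on the body `CP^n`. -/
def bodyPartition (k l : Fin (n + 1)) (w : Fin n → ℂ) : ℝ := bump k l w / ∑ a, bump a l w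

theorem contDiff_bodyPartition (k l : Fin (n + 1)) : ContDiff ℝ ∞ (bodyPartition k l) := by
  have h : ∀ a, ContDiff ℝ ∞ (bump a l) := fun a =>
    (Real.smoothTransition.contDiff (n := ⊤)).comp ((contDiff_weight a l).sub contDiff_const)
  exact (h k).div (ContDiff.sum fun a _ => h a) fun w => (sum_bump_pos l w).ne'

theorem bodyPartition_transition (j : Fin (n + 1)) {k l : Fin (n + 1)} {w : Fin n → ℂ}
    (h : homog k w l ≠ 0) : bodyPartition j l (transition k l w) = bodyPartition j k w := by
  simp only [bodyPartition, bump, weight_transition _ h]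

theorem hasCompactSupport_bodyPartition (k : Fin (n + 1)) :
    HasCompactSupport (bodyPartition k k : (Fin n → ℂ) → ℝ) := by
  -- In its own chart the weight is 1/r, so the bump vanishes once r ≥ 2(n+1); outside the ball of
  -- this radius that holds with room to spare.
  refine HasCompactSupport.intro (isCompact_closedBall (0 : Fin n → ℂ) (2 * (n + 1))) fun w hw => ?_
  rw [mem_closedBall_zero_iff, not_le] at hw
  have hn : (0 : ℝ) ≤ n := Nat.cast_nonneg n
  have h1 : 2 * ((n : ℝ) + 1) ≤ bodySq w := by
    by_contra! hlt
    refine hw.not_ge ((pi_norm_le_iff_of_nonneg (by positivity)).mpr fun a => ?_)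
    have h2 : Complex.normSq (w a) ≤ ∑ b, Complex.normSq (w b) :=
      Finset.single_le_sum (f := fun b => Complex.normSq (w b))
        (fun b _ => Complex.normSq_nonneg _) (Finset.mem_univ a)
    rw [bodySq] at hlt
    rw [Complex.normSq_eq_norm_sq] at h2
    nlinarith [sq_nonneg (‖w a‖ - 1), norm_nonneg (w a)]
  rw [bodyPartition, bump_eq_zero, zero_div]
  rw [weight, homog_self, map_one]
  exact one_div_le_one_div_of_le (by positivity) h1

theorem isSmooth_algebraMap {f : (Fin n → ℂ) → ℝ} (hf : ContDiff ℝ ∞ f) :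
    IsSmooth fun w => algebraMap ℂ (Grassmann m) (f w) := by
  intro s
  simp only [Algebra.algebraMap_eq_smul_one, map_smul, Finsupp.smul_apply, smul_eq_mul]
  exact (Complex.ofRealCLM.contDiff.comp hf).mul contDiff_const

/-- A partition on the body CP^n, taken constant in the odd coordinates, is compatible because odd
substitutions fix scalars. -/
instance nonempty_partitionOfUnity : Nonempty (PartitionOfUnity n m) :=
  ⟨{ ρ := fun k =>
      { toFun := fun l w => algebraMap ℂ (Grassmann m) (bodyPartition k l w)
        smooth := fun l => isSmooth_algebraMap (contDiff_bodyPartition k l)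
        compatible := fun l j w h => by
          rw [pullback, bodyPartition_transition k h, AlgHom.commutes] }
     even := fun k l w => (EvenGrassmann m).algebraMap_mem _
     compact_support := fun k => by
      refine (hasCompactSupport_bodyPartition k).comp_left
        (g := fun r : ℝ => algebraMap ℂ (Grassmann m) (r : ℂ)) ?_
      rw [Complex.ofReal_zero, map_zero]
     vanishing := fun k l w h => by
      have : bump k l w = 0 := bump_eq_zero (by
        rw [weight, h, map_zero, zero_div]
        positivity)
      simp only [bodyPartition, this, zero_div, Complex.ofReal_zero, map_zero]
     sum_eq_one := fun l w => by
      rw [← map_sum, ← Complex.ofReal_sum]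
      simp only [bodyPartition]
      rw [← Finset.sum_div, div_self (sum_bump_pos l w).ne', Complex.ofReal_one, map_one] }⟩

/-! ### The volume -/

theorem hasTotalIntegral_smul_evalTau {D : Fin (n + 1) → ChartFun n m} (c : ℝ)
    (hD : ∀ k w, D k w = (((c : ℂ) • evalTau m (fun x => x ^ ((m : ℤ) - n - 1)) (bodySq w) :
      EvenGrassmann m) : Grassmann m)) :
    HasTotalIntegral D
      ((c * (Real.pi ^ n * 2 ^ m / Real.Gamma ((n : ℝ) - (m : ℝ) + 1)) : ℝ) : ℂ) := by
  refine ⟨nonempty_partitionOfUnity, fun P => ?_⟩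
  have h : ∀ k w, oddIntegral ((P.ρ k).toFun k w * D k w)
      = (c : ℂ) * oddIntegral ((P.ρ k).toFun k w *
        (evalTau m (fun x => x ^ ((m : ℤ) - n - 1)) (bodySq w) : Grassmann m)) := by
    intro k w
    rw [hD, Subalgebra.coe_smul, mul_smul_comm, map_smul, smul_eq_mul]
  simp only [h]
  refine ⟨fun k => (integrable_oddIntegral_mul ((P.ρ k).smooth k)
    (P.compact_support k) _).const_mul _, ?_⟩
  simp only [integral_const_mul]
  rw [← Finset.mul_sum, sum_integral_partition, ← Complex.ofReal_mul]

theorem hasTotalIntegral_riemannianVolumeElement (n m : ℕ) {R : ℝ} (hR : 0 < R) :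
    HasTotalIntegral (riemannianVolumeElement n m R)
      ((R ^ (2 * ((n : ℤ) - (m : ℤ))) *
        (Real.pi ^ n * 2 ^ m / Real.Gamma ((n : ℝ) - (m : ℝ) + 1)) : ℝ) : ℂ) :=
  hasTotalIntegral_smul_evalTau _ fun k w => riemannianVolumeElement_eq k w hR

theorem hasTotalIntegral_liouvilleVolumeElement (n m : ℕ) {R : ℝ} (hR : 0 < R) :
    HasTotalIntegral (liouvilleVolumeElement n m R)
      ((R ^ (2 * ((n : ℤ) - (m : ℤ))) *
        (Real.pi ^ n * 2 ^ m / Real.Gamma ((n : ℝ) - (m : ℝ) + 1)) : ℝ) : ℂ) :=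
  hasTotalIntegral_smul_evalTau _ fun k w => liouvilleVolumeElement_eq k w hR

theorem Gamma_sub_add_one_eq_zero {n m : ℕ} (h : n < m) :
    Real.Gamma ((n : ℝ) - (m : ℝ) + 1) = 0 := by
  obtain ⟨d, rfl⟩ := Nat.exists_eq_add_of_lt h
  have : (n : ℝ) - ((n + d + 1 : ℕ) : ℝ) + 1 = -(d : ℝ) := by
    push_cast
    ring
  rw [this, Real.Gamma_neg_nat_eq_zero]

end Volume

end SuperCP

end

theorem mainTheorem3 :
    (∀ (n m : ℕ) (R : ℝ), 0 < R →
      SuperCP.HasTotalIntegral (SuperCP.riemannianVolumeElement n m R)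
        ((R ^ (2 * ((n : ℤ) - (m : ℤ))) *
          (Real.pi ^ n * 2 ^ m / Real.Gamma ((n : ℝ) - (m : ℝ) + 1)) : ℝ) : ℂ) ∧
      SuperCP.HasTotalIntegral (SuperCP.liouvilleVolumeElement n m R)
        ((R ^ (2 * ((n : ℤ) - (m : ℤ))) *
          (Real.pi ^ n * 2 ^ m / Real.Gamma ((n : ℝ) - (m : ℝ) + 1)) : ℝ) : ℂ)) ∧
    (∀ (n m : ℕ) (R : ℝ), 0 < R → n < m →
      SuperCP.HasTotalIntegral (SuperCP.riemannianVolumeElement n m R) 0 ∧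
      SuperCP.HasTotalIntegral (SuperCP.liouvilleVolumeElement n m R) 0) ∧
    (∀ R : ℝ, 0 < R →
      SuperCP.HasTotalIntegral (SuperCP.riemannianVolumeElement 1 1 R)
        ((2 * Real.pi : ℝ) : ℂ) ∧
      SuperCP.HasTotalIntegral (SuperCP.liouvilleVolumeElement 1 1 R)
        ((2 * Real.pi : ℝ) : ℂ)) := by
  refine ⟨fun n m R hR => ⟨SuperCP.hasTotalIntegral_riemannianVolumeElement n m hR,
    SuperCP.hasTotalIntegral_liouvilleVolumeElement n m hR⟩, fun n m R hR h => ?_, fun R hR => ?_⟩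
  · have h1 := SuperCP.hasTotalIntegral_riemannianVolumeElement n m hR
    have h2 := SuperCP.hasTotalIntegral_liouvilleVolumeElement n m hR
    -- At its poles `Real.Gamma` takes the value 0, and division by 0 gives 0, which agrees with 1/Γ
    -- = 0 there.
    rw [SuperCP.Gamma_sub_add_one_eq_zero h, div_zero, mul_zero, Complex.ofReal_zero] at h1 h2
    exact ⟨h1, h2⟩
  · have h1 := SuperCP.hasTotalIntegral_riemannianVolumeElement 1 1 hR
    have h2 := SuperCP.hasTotalIntegral_liouvilleVolumeElement 1 1 hR
    have hV : R ^ (2 * (((1 : ℕ) : ℤ) - ((1 : ℕ) : ℤ))) *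
        (Real.pi ^ 1 * 2 ^ 1 / Real.Gamma (((1 : ℕ) : ℝ) - ((1 : ℕ) : ℝ) + 1))
        = 2 * Real.pi := by
      rw [sub_self, sub_self, mul_zero, zpow_zero, zero_add, Real.Gamma_one]
      ring
    rw [hV] at h1 h2
    exact ⟨h1, h2⟩
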